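/- Let $k$ be an algebraically closed field of characteristic $0$. A finite-dimensional associative unital $k$-algebra $R$ is called Frobenius if there is a bilinear form $(-,-):R\times R\to k$ with $(ab,c)=(a,bc)$ for all $a,b,c\in R$ such that for every nonzero $a\in R$ there are $b,c\in R$ with $(a,b)\neq 0$ and $(c,a)\neq 0$. For $\lambda\in k$ put $k_\lambda[x,y]=k\langle x,y\rangle/(xy-\lambda yx)$. Consider the following list of $k$-algebras. (I) $k^4$, $k^2\times k[x]/(x^2)$, $k\times k[x]/(x^3)$, $(k[x]/(x^2))^2$, $k[x]/(x^4)$, $k[x,y]/(x^2,y^2)$. (II) $M_2(k)$; $kQ/(xy,yx)$, where $kQ$ is the path algebra of the quiver $Q$ with two vertices $1,2$ and two arrows $x:1\to 2$, $y:2\to 1$; $k_{-1}[x,y]/(x^2,y^2+yx)$; and $k_\lambda[x,y]/(x^2,y^2)$ for each $\lambda\in k\setminus\{0,1\}$. Then every algebra in the list is a $4$-dimensional Frobenius algebra, those in (I) are commutative, and those in (II) are not commutative. Every $4$-dimensional Frobenius $k$-algebra is isomorphic, as a $k$-algebra, to an algebra in the list. Two different entries of the list are never isomorphic as $k$-algebras,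 except that for $\lambda,\lambda'\in k\setminus\{0,1\}$ one has $k_\lambda[x,y]/(x^2,y^2)\cong k_{\lambda'}[x,y]/(x^2,y^2)$ if and only if $\lambda'=\lambda^{\pm1}$. -/

import Mathlib

open Polynomial

universe u v w

/-- A `k`-algebra is Frobenius if it is finite-dimensional and carries an associative
nondegenerate bilinear form. -/
structure IsFrobeniusAlgebra (k : Type u) (R : Type v) [Field k] [Ring R] [Algebra k R] :
    Prop where
  finite : Module.Finite k R
  exists_form : ∃ B : R →ₗ[k] R →ₗ[k] k,
    (∀ a b c : R, B (a * b) c = B a (b * c)) ∧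
    (∀ a : R, a ≠ 0 → ∃ b c : R, B a b ≠ 0 ∧ B c a ≠ 0)

/-- `R / (s)`, the quotient of the ring `R` by the two-sided ideal generated by `s`. -/
abbrev QuotientBy {R : Type u} [Ring R] (s : Set R) : Type u :=
  RingQuot (fun a b : R => a ∈ s ∧ b = 0)

/-- The class in `R / (s)` of an element of `R`. -/
noncomputable def QuotientBy.mk {R : Type u} [Ring R] (s : Set R) : R →+* QuotientBy s :=
  RingQuot.mkRingHom _

section SkewPolynomials

variable (k : Type u) [Field k]

/-- `k_lam[x, y] = k⟨x, y⟩ / (xy - lam yx)`. -/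
abbrev QuantumPlane (lam : k) : Type u :=
  QuotientBy ({FreeAlgebra.ι k 0 * FreeAlgebra.ι k 1
    - lam • (FreeAlgebra.ι k 1 * FreeAlgebra.ι k 0)} : Set (FreeAlgebra k (Fin 2)))

namespace QuantumPlane

/-- The generator `x` of `k_lam[x, y]`. -/
noncomputable def x (lam : k) : QuantumPlane k lam :=
  QuotientBy.mk _ (FreeAlgebra.ι k (0 : Fin 2))

/-- The generator `y` of `k_lam[x, y]`. -/
noncomputable def y (lam : k) : QuantumPlane k lam :=
  QuotientBy.mk _ (FreeAlgebra.ι k (1 : Fin 2))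

end QuantumPlane

/-- `k_lam[x, y] / (x², y²)`. -/
abbrev SkewSquares (lam : k) : Type u :=
  QuotientBy ({QuantumPlane.x k lam ^ 2, QuantumPlane.y k lam ^ 2} :
    Set (QuantumPlane k lam))

/-- `k_{-1}[x, y] / (x², y² + yx)`. -/
abbrev SkewJordan : Type u :=
  QuotientBy ({QuantumPlane.x k (-1) ^ 2,
    QuantumPlane.y k (-1) ^ 2 + QuantumPlane.y k (-1) * QuantumPlane.x k (-1)} :
    Set (QuantumPlane k (-1)))

end SkewPolynomials

section PathAlgebras

/-- The generators of a path algebra: the trivial paths at the vertices, and the arrows. -/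
inductive PathGenerator (V : Type v) [Quiver.{w} V] : Type (max v w)
  | vertex (a : V) : PathGenerator V
  | arrow {a b : V} (f : a ⟶ b) : PathGenerator V

variable (k : Type u) [Field k] (V : Type v) [Quiver.{w} V] [Fintype V]

/-- The defining relations of the path algebra, paths being composed from left to right:
the `e_a` are orthogonal idempotents with sum `1`, and `e_a f = f = f e_b` for an arrow
`f : a ⟶ b`. -/
inductive PathRelation :
    FreeAlgebra k (PathGenerator V) → FreeAlgebra k (PathGenerator V) → Prop
  | idempotent (a : V) :
      PathRelation (FreeAlgebra.ι k (.vertex a) * FreeAlgebra.ι k (.vertex a))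
        (FreeAlgebra.ι k (.vertex a))
  | orthogonal (a b : V) (h : a ≠ b) :
      PathRelation (FreeAlgebra.ι k (.vertex a) * FreeAlgebra.ι k (.vertex b)) 0
  | complete : PathRelation (∑ a : V, FreeAlgebra.ι k (.vertex a)) 1
  | source {a b : V} (f : a ⟶ b) :
      PathRelation (FreeAlgebra.ι k (.vertex a) * FreeAlgebra.ι k (.arrow f))
        (FreeAlgebra.ι k (.arrow f))
  | target {a b : V} (f : a ⟶ b) :
      PathRelation (FreeAlgebra.ι k (.arrow f) * FreeAlgebra.ι k (.vertex b))
        (FreeAlgebra.ι k (.arrow f))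

/-- The path algebra `kQ` of a quiver `Q` with finitely many vertices. A product of arrows that
do not match up is zero by orthogonality, so that the paths form a `k`-basis. -/
abbrev PathAlgebra : Type (max u v w) := RingQuot (PathRelation k V)

variable {V}

/-- An arrow of `Q` as an element of `kQ`. -/
noncomputable def PathAlgebra.ofArrow {a b : V} (f : a ⟶ b) : PathAlgebra k V :=
  RingQuot.mkAlgHom k (PathRelation k V) (FreeAlgebra.ι k (.arrow f))

end PathAlgebras

/-- The vertices of the 2-cycle quiver. -/
inductive TwoCycle : Type
  | one : TwoCycle
  | two : TwoCycle

/-- The arrows `x : 1 → 2` and `y : 2 → 1` of the 2-cycle quiver. -/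
inductive TwoCycle.Arrow : TwoCycle → TwoCycle → Type
  | x : TwoCycle.Arrow TwoCycle.one TwoCycle.two
  | y : TwoCycle.Arrow TwoCycle.two TwoCycle.one

instance TwoCycle.instQuiver : Quiver TwoCycle := ⟨TwoCycle.Arrow⟩

instance TwoCycle.instFintype : Fintype TwoCycle :=
  ⟨⟨{TwoCycle.one, TwoCycle.two}, by simp⟩, by rintro (_ | _) <;> simp⟩

section TwoCycleAlgebras

variable (k : Type u) [Field k]

/-- The element `x` of the path algebra of the 2-cycle quiver. -/
noncomputable def TwoCycle.x : PathAlgebra k TwoCycle :=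
  PathAlgebra.ofArrow k (a := TwoCycle.one) (b := TwoCycle.two) TwoCycle.Arrow.x

/-- The element `y` of the path algebra of the 2-cycle quiver. -/
noncomputable def TwoCycle.y : PathAlgebra k TwoCycle :=
  PathAlgebra.ofArrow k (a := TwoCycle.two) (b := TwoCycle.one) TwoCycle.Arrow.y

/-- The path algebra of the 2-cycle quiver modulo `(xy, yx)`. -/
abbrev TwoCycleAlgebra : Type u :=
  QuotientBy ({TwoCycle.x k * TwoCycle.y k, TwoCycle.y k * TwoCycle.x k} :
    Set (PathAlgebra k TwoCycle))

/-- `k[x] / (xⁿ)`. -/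
abbrev TruncatedPolynomial (n : ℕ) : Type u :=
  k[X] ⧸ Ideal.span ({X ^ n} : Set k[X])

/-- `k[x, y] / (x², y²)`. -/
abbrev CommutativeSquares : Type u :=
  MvPolynomial (Fin 2) k ⧸
    Ideal.span ({MvPolynomial.X 0 ^ 2, MvPolynomial.X 1 ^ 2} : Set (MvPolynomial (Fin 2) k))

end TwoCycleAlgebras

/-- The entries of the table of 4-dimensional Frobenius algebras. -/
inductive FrobeniusTable (k : Type u) [Field k] : Type u
  | split : FrobeniusTable k
  | splitDual : FrobeniusTable k
  | splitCubic : FrobeniusTable k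
  | dualDual : FrobeniusTable k
  | quartic : FrobeniusTable k
  | squares : FrobeniusTable k
  | matrix : FrobeniusTable k
  | twoCycle : FrobeniusTable k
  | jordan : FrobeniusTable k
  | skew (lam : k) (h0 : lam ≠ 0) (h1 : lam ≠ 1) : FrobeniusTable k

namespace FrobeniusTable

variable {k : Type u} [Field k]

/-- The `k`-algebra that an entry of the table names. -/
noncomputable def alg : FrobeniusTable k → AlgCat.{u} k
  | split => AlgCat.of k (Fin 4 → k)
  | splitDual => AlgCat.of k ((Fin 2 → k) × TruncatedPolynomial k 2)
  | splitCubic => AlgCat.of k (k × TruncatedPolynomial k 3)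
  | dualDual => AlgCat.of k (TruncatedPolynomial k 2 × TruncatedPolynomial k 2)
  | quartic => AlgCat.of k (TruncatedPolynomial k 4)
  | squares => AlgCat.of k (CommutativeSquares k)
  | matrix => AlgCat.of k (Matrix (Fin 2) (Fin 2) k)
  | twoCycle => AlgCat.of k (TwoCycleAlgebra k)
  | jordan => AlgCat.of k (SkewJordan k)
  | skew lam _ _ => AlgCat.of k (SkewSquares k lam)

/-- The six entries in the commutative half of the table. -/
def InCommutativeHalf : FrobeniusTable k → Prop
  | split | splitDual | splitCubic | dualDual | quartic | squares => True
  | matrix | twoCycle | jordan | skew _ _ _ => False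

end FrobeniusTable

/-! Let `E` be a 4-dimensional Frobenius algebra with functional `φ` nonzero on every nonzero
one-sided ideal. The proof splits by the idempotents of `E`.

Suppose that 0 and 1 are the only idempotents. By Fitting's argument every element is a unit or
nilpotent, so `E = k ⊕ J` with `J` a nilpotent ideal of dimension 3. If `J/J²` is at most a line, a
Nakayama argument shows that `E` is generated by one element. If `J² = 0`, then `φ` would be
injective on `J`, which is absurd. What remains is `J² = kz` with `Jz = zJ = 0`, where
multiplication is a bilinear form on the plane `J/J²` with values in `kz`. This is `FormAlg p q r
s`. It is Frobenius exactly when the form is nondegenerate, and isomorphisms amount to congruence up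
to a scalar. An isotropic vector reduces the form to `x² = 0`, `xy = λz`, `yx = z`, `y² = sz`. A
shear removes `s` unless `λ = -1`, and the exceptional case with `s ≠ 0` is the Jordan entry.

Suppose that there is a central idempotent other than 0 and 1. Then `E` is a product of Frobenius
algebras of dimension at most 3. The same analysis in lower dimension shows that these are generated
by one element, and so is their product, since a scalar shift makes the minimal polynomials coprime.
An algebra with one generator is `k[X]` modulo a minimal polynomial, so the coincidences among its
four roots determine the entry.

Suppose that some idempotent `e` is not central. For a Frobenius algebra the Peirce corners
`eE(1-e)` and `(1-e)Ee` vanish together, hence both contain nonzero elements `x` and `y`. Then `e,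
1-e, x, y` is a basis and `xy = αe`, `yx = α(1-e)`. This is `PeirceAlg α`, which is the matrix
algebra for `α ≠ 0` and the 2-cycle algebra for `α = 0`.

The entries are told apart by commutativity, by which powers of nilpotents survive and by
idempotents. Square-zero elements separate the two Peirce algebras. Inside the family, the
determinant and the antisymmetric part of the form determine `λ` up to inversion. -/

/-! ### Two model families with explicit structure constants -/

section FormAlgebras

variable {k : Type u} [Field k]

/-- The algebra with basis `1, x, y, z`, where `x² = pz`, `xy = qz`, `yx = rz`, `y² = sz`, and all
other products of `x, y, z` vanish. -/
@[nolint unusedArguments]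
def FormAlg (_p _q _r _s : k) : Type u := k × k × k × k

/-- The algebra with basis `e, f, x, y`, where `e, f` are orthogonal idempotents with sum `1`,
`x = ex = xf`, `y = fy = ye`, `xy = αe`, `yx = αf`. -/
@[nolint unusedArguments]
def PeirceAlg (_α : k) : Type u := k × k × k × k

namespace FormAlg

variable {p q r s : k}

instance : AddCommGroup (FormAlg p q r s) := inferInstanceAs (AddCommGroup (k × k × k × k))

instance : Module k (FormAlg p q r s) := inferInstanceAs (Module k (k × k × k × k))

/-- The element `a + bx + cy + dz`. -/
def mk (a b c d : k) : FormAlg p q r s := (a, b, c, d)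

lemma mk_surj (u : FormAlg p q r s) : ∃ a b c d : k, u = mk a b c d :=
  ⟨u.1, u.2.1, u.2.2.1, u.2.2.2, rfl⟩

lemma mk_inj {a b c d a' b' c' d' : k} :
    (mk a b c d : FormAlg p q r s) = mk a' b' c' d' ↔ a = a' ∧ b = b' ∧ c = c' ∧ d = d' := by
  constructor
  · intro h
    have h' : ((a, b, c, d) : k × k × k × k) = (a', b', c', d') := h
    simpa using h'
  · rintro ⟨rfl, rfl, rfl, rfl⟩
    rfl

instance : Mul (FormAlg p q r s) where
  mul u v := (u.1 * v.1, u.1 * v.2.1 + u.2.1 * v.1, u.1 * v.2.2.1 + u.2.2.1 * v.1,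
    u.1 * v.2.2.2 + u.2.2.2 * v.1 + p * u.2.1 * v.2.1 + q * u.2.1 * v.2.2.1
      + r * u.2.2.1 * v.2.1 + s * u.2.2.1 * v.2.2.1)

instance : One (FormAlg p q r s) where
  one := (1, 0, 0, 0)

lemma zero_def : (0 : FormAlg p q r s) = mk 0 0 0 0 := rfl

lemma one_def : (1 : FormAlg p q r s) = mk 1 0 0 0 := rfl

lemma mk_add (a b c d a' b' c' d' : k) :
    (mk a b c d + mk a' b' c' d' : FormAlg p q r s) = mk (a + a') (b + b') (c + c') (d + d') := rfl

lemma smul_mk (t a b c d : k) :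
    (t • mk a b c d : FormAlg p q r s) = mk (t * a) (t * b) (t * c) (t * d) := rfl

lemma mk_mul (a b c d a' b' c' d' : k) :
    (mk a b c d * mk a' b' c' d' : FormAlg p q r s) =
      mk (a * a') (a * b' + b * a') (a * c' + c * a')
        (a * d' + d * a' + p * b * b' + q * b * c' + r * c * b' + s * c * c') := rfl

instance : Ring (FormAlg p q r s) :=
  { (inferInstance : AddCommGroup (FormAlg p q r s)),
    (inferInstance : Mul (FormAlg p q r s)),
    (inferInstance : One (FormAlg p q r s)) with
    left_distrib := fun u v w => by
      obtain ⟨a, b, c, d, rfl⟩ := mk_surj u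
      obtain ⟨a', b', c', d', rfl⟩ := mk_surj v
      obtain ⟨a'', b'', c'', d'', rfl⟩ := mk_surj w
      simp only [mk_add, mk_mul, mk_inj]
      refine ⟨?_, ?_, ?_, ?_⟩ <;> ring
    right_distrib := fun u v w => by
      obtain ⟨a, b, c, d, rfl⟩ := mk_surj u
      obtain ⟨a', b', c', d', rfl⟩ := mk_surj v
      obtain ⟨a'', b'', c'', d'', rfl⟩ := mk_surj w
      simp only [mk_add, mk_mul, mk_inj]
      refine ⟨?_, ?_, ?_, ?_⟩ <;> ring
    zero_mul := fun u => by
      obtain ⟨a, b, c, d, rfl⟩ := mk_surj u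
      simp [zero_def, mk_mul]
    mul_zero := fun u => by
      obtain ⟨a, b, c, d, rfl⟩ := mk_surj u
      simp [zero_def, mk_mul]
    mul_assoc := fun u v w => by
      obtain ⟨a, b, c, d, rfl⟩ := mk_surj u
      obtain ⟨a', b', c', d', rfl⟩ := mk_surj v
      obtain ⟨a'', b'', c'', d'', rfl⟩ := mk_surj w
      simp only [mk_mul, mk_inj]
      refine ⟨?_, ?_, ?_, ?_⟩ <;> ring
    one_mul := fun u => by
      obtain ⟨a, b, c, d, rfl⟩ := mk_surj u
      simp [one_def, mk_mul]
    mul_one := fun u => by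
      obtain ⟨a, b, c, d, rfl⟩ := mk_surj u
      simp [one_def, mk_mul]
    neg_add_cancel := neg_add_cancel
    zsmul := (· • ·)
    zsmul_zero' := SubNegMonoid.zsmul_zero'
    zsmul_succ' := SubNegMonoid.zsmul_succ'
    zsmul_neg' := SubNegMonoid.zsmul_neg' }

instance : Algebra k (FormAlg p q r s) :=
  Algebra.ofModule
    (fun t u v => by
      obtain ⟨a, b, c, d, rfl⟩ := mk_surj u
      obtain ⟨a', b', c', d', rfl⟩ := mk_surj v
      simp only [smul_mk, mk_mul, mk_inj]
      refine ⟨?_, ?_, ?_, ?_⟩ <;> ring)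
    (fun t u v => by
      obtain ⟨a, b, c, d, rfl⟩ := mk_surj u
      obtain ⟨a', b', c', d', rfl⟩ := mk_surj v
      simp only [smul_mk, mk_mul, mk_inj]
      refine ⟨?_, ?_, ?_, ?_⟩ <;> ring)

instance : Module.Finite k (FormAlg p q r s) := inferInstanceAs (Module.Finite k (k × k × k × k))

lemma finrank_eq : Module.finrank k (FormAlg p q r s) = 4 := by
  change Module.finrank k (k × k × k × k) = 4
  simp

/-- The homomorphism out of `FormAlg p q r s` given by elements that satisfy its relations. -/
def lift {A : Type v} [Ring A] [Algebra k A] (x y z : A) (hxx : x * x = p • z) (hxy : x * y = q • z)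
    (hyx : y * x = r • z) (hyy : y * y = s • z) (hxz : x * z = 0) (hzx : z * x = 0)
    (hyz : y * z = 0) (hzy : z * y = 0) (hzz : z * z = 0) : FormAlg p q r s →ₐ[k] A :=
  AlgHom.ofLinearMap
    { toFun := fun u => u.1 • (1 : A) + u.2.1 • x + u.2.2.1 • y + u.2.2.2 • z
      map_add' := fun u v => by
        change (u.1 + v.1) • (1 : A) + (u.2.1 + v.2.1) • x + (u.2.2.1 + v.2.2.1) • y
          + (u.2.2.2 + v.2.2.2) • z = _
        module
      map_smul' := fun t u => by
        change (t * u.1) • (1 : A) + (t * u.2.1) • x + (t * u.2.2.1) • y + (t * u.2.2.2) • z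
          = t • (u.1 • (1 : A) + u.2.1 • x + u.2.2.1 • y + u.2.2.2 • z)
        module }
    (by
      change (1 : k) • (1 : A) + (0 : k) • x + (0 : k) • y + (0 : k) • z = 1
      module)
    (fun u v => by
      obtain ⟨a, b, c, d, rfl⟩ := mk_surj u
      obtain ⟨a', b', c', d', rfl⟩ := mk_surj v
      rw [mk_mul]
      simp only [LinearMap.coe_mk, AddHom.coe_mk, mk, mul_add, add_mul, smul_mul_smul_comm, one_mul,
        mul_one, hxx, hxy, hyx, hyy, hxz, hzx, hyz, hzy, hzz, smul_zero]
      module)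

end FormAlg

namespace PeirceAlg

variable {α : k}

instance : AddCommGroup (PeirceAlg α) := inferInstanceAs (AddCommGroup (k × k × k × k))

instance : Module k (PeirceAlg α) := inferInstanceAs (Module k (k × k × k × k))

/-- The element `ae + bf + cx + dy`. -/
def mk (a b c d : k) : PeirceAlg α := (a, b, c, d)

lemma mk_surj (u : PeirceAlg α) : ∃ a b c d : k, u = mk a b c d :=
  ⟨u.1, u.2.1, u.2.2.1, u.2.2.2, rfl⟩

lemma mk_inj {a b c d a' b' c' d' : k} :
    (mk a b c d : PeirceAlg α) = mk a' b' c' d' ↔ a = a' ∧ b = b' ∧ c = c' ∧ d = d' := by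
  constructor
  · intro h
    have h' : ((a, b, c, d) : k × k × k × k) = (a', b', c', d') := h
    simpa using h'
  · rintro ⟨rfl, rfl, rfl, rfl⟩
    rfl

instance : Mul (PeirceAlg α) where
  mul u v := (u.1 * v.1 + α * u.2.2.1 * v.2.2.2, u.2.1 * v.2.1 + α * u.2.2.2 * v.2.2.1,
    u.1 * v.2.2.1 + u.2.2.1 * v.2.1, u.2.2.2 * v.1 + u.2.1 * v.2.2.2)

instance : One (PeirceAlg α) where
  one := (1, 1, 0, 0)

lemma zero_def : (0 : PeirceAlg α) = mk 0 0 0 0 := rfl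

lemma one_def : (1 : PeirceAlg α) = mk 1 1 0 0 := rfl

lemma mk_add (a b c d a' b' c' d' : k) :
    (mk a b c d + mk a' b' c' d' : PeirceAlg α) = mk (a + a') (b + b') (c + c') (d + d') := rfl

lemma smul_mk (t a b c d : k) :
    (t • mk a b c d : PeirceAlg α) = mk (t * a) (t * b) (t * c) (t * d) := rfl

lemma mk_mul (a b c d a' b' c' d' : k) :
    (mk a b c d * mk a' b' c' d' : PeirceAlg α) =
      mk (a * a' + α * c * d') (b * b' + α * d * c') (a * c' + c * b') (d * a' + b * d') := rfl

instance : Ring (PeirceAlg α) :=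
  { (inferInstance : AddCommGroup (PeirceAlg α)),
    (inferInstance : Mul (PeirceAlg α)),
    (inferInstance : One (PeirceAlg α)) with
    left_distrib := fun u v w => by
      obtain ⟨a, b, c, d, rfl⟩ := mk_surj u
      obtain ⟨a', b', c', d', rfl⟩ := mk_surj v
      obtain ⟨a'', b'', c'', d'', rfl⟩ := mk_surj w
      simp only [mk_add, mk_mul, mk_inj]
      refine ⟨?_, ?_, ?_, ?_⟩ <;> ring
    right_distrib := fun u v w => by
      obtain ⟨a, b, c, d, rfl⟩ := mk_surj u
      obtain ⟨a', b', c', d', rfl⟩ := mk_surj v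
      obtain ⟨a'', b'', c'', d'', rfl⟩ := mk_surj w
      simp only [mk_add, mk_mul, mk_inj]
      refine ⟨?_, ?_, ?_, ?_⟩ <;> ring
    zero_mul := fun u => by
      obtain ⟨a, b, c, d, rfl⟩ := mk_surj u
      simp [zero_def, mk_mul]
    mul_zero := fun u => by
      obtain ⟨a, b, c, d, rfl⟩ := mk_surj u
      simp [zero_def, mk_mul]
    mul_assoc := fun u v w => by
      obtain ⟨a, b, c, d, rfl⟩ := mk_surj u
      obtain ⟨a', b', c', d', rfl⟩ := mk_surj v
      obtain ⟨a'', b'', c'', d'', rfl⟩ := mk_surj w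
      simp only [mk_mul, mk_inj]
      refine ⟨?_, ?_, ?_, ?_⟩ <;> ring
    one_mul := fun u => by
      obtain ⟨a, b, c, d, rfl⟩ := mk_surj u
      simp [one_def, mk_mul]
    mul_one := fun u => by
      obtain ⟨a, b, c, d, rfl⟩ := mk_surj u
      simp [one_def, mk_mul]
    neg_add_cancel := neg_add_cancel
    zsmul := (· • ·)
    zsmul_zero' := SubNegMonoid.zsmul_zero'
    zsmul_succ' := SubNegMonoid.zsmul_succ'
    zsmul_neg' := SubNegMonoid.zsmul_neg' }

instance : Algebra k (PeirceAlg α) :=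
  Algebra.ofModule
    (fun t u v => by
      obtain ⟨a, b, c, d, rfl⟩ := mk_surj u
      obtain ⟨a', b', c', d', rfl⟩ := mk_surj v
      simp only [smul_mk, mk_mul, mk_inj]
      refine ⟨?_, ?_, ?_, ?_⟩ <;> ring)
    (fun t u v => by
      obtain ⟨a, b, c, d, rfl⟩ := mk_surj u
      obtain ⟨a', b', c', d', rfl⟩ := mk_surj v
      simp only [smul_mk, mk_mul, mk_inj]
      refine ⟨?_, ?_, ?_, ?_⟩ <;> ring)

instance : Module.Finite k (PeirceAlg α) := inferInstanceAs (Module.Finite k (k × k × k × k))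

lemma finrank_eq : Module.finrank k (PeirceAlg α) = 4 := by
  change Module.finrank k (k × k × k × k) = 4
  simp

/-- The homomorphism out of `PeirceAlg α` given by elements that satisfy its relations. -/
def lift {A : Type v} [Ring A] [Algebra k A] (e f x y : A) (h1 : e + f = 1) (hef : e * f = 0)
    (hfe : f * e = 0) (hex : e * x = x) (hxf : x * f = x) (hfy : f * y = y) (hye : y * e = y)
    (hxy : x * y = α • e) (hyx : y * x = α • f) : PeirceAlg α →ₐ[k] A :=
  AlgHom.ofLinearMap
    { toFun := fun u => u.1 • e + u.2.1 • f + u.2.2.1 • x + u.2.2.2 • y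
      map_add' := fun u v => by
        change (u.1 + v.1) • e + (u.2.1 + v.2.1) • f + (u.2.2.1 + v.2.2.1) • x
          + (u.2.2.2 + v.2.2.2) • y = _
        module
      map_smul' := fun t u => by
        change (t * u.1) • e + (t * u.2.1) • f + (t * u.2.2.1) • x + (t * u.2.2.2) • y
          = t • (u.1 • e + u.2.1 • f + u.2.2.1 • x + u.2.2.2 • y)
        module }
    (by
      change (1 : k) • e + (1 : k) • f + (0 : k) • x + (0 : k) • y = 1
      rw [← h1]
      module)
    (fun u v => by
      have hee : e * e = e := by
        have := congrArg (e * ·) h1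
        simpa [mul_add, hef] using this
      have hff : f * f = f := by
        have := congrArg (f * ·) h1
        simpa [mul_add, hfe] using this
      have hfx : f * x = 0 := by rw [← hex, ← mul_assoc, hfe, zero_mul]
      have hxe : x * e = 0 := by rw [← hxf, mul_assoc, hfe, mul_zero]
      have hey : e * y = 0 := by rw [← hfy, ← mul_assoc, hef, zero_mul]
      have hyf : y * f = 0 := by rw [← hye, mul_assoc, hef, mul_zero]
      have hxx : x * x = 0 := by rw [← hex, mul_assoc, ← mul_assoc x, hxe, zero_mul, mul_zero]
      have hyy : y * y = 0 := by rw [← hfy, mul_assoc, ← mul_assoc y, hyf, zero_mul, mul_zero]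
      obtain ⟨a, b, c, d, rfl⟩ := mk_surj u
      obtain ⟨a', b', c', d', rfl⟩ := mk_surj v
      rw [mk_mul]
      simp only [LinearMap.coe_mk, AddHom.coe_mk, mk, mul_add, add_mul, smul_mul_smul_comm, hef,
        hfe, hex, hxf, hfy, hye, hxy, hyx, hee, hff, hfx, hxe, hey, hyf, hxx, hyy, smul_zero]
      module)

end PeirceAlg

end FormAlgebras

/-! ### Presentations of the local table entries by bilinear forms -/

section QuotientPresentations

namespace QuotientBy

variable {k : Type u} [Field k] {R : Type v} [Ring R] [Algebra k R] {s : Set R}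

lemma mk_eq_zero {a : R} (ha : a ∈ s) : QuotientBy.mk s a = 0 := by
  have h := RingQuot.mkRingHom_rel (r := fun a b : R => a ∈ s ∧ b = 0) ⟨ha, rfl⟩
  rw [map_zero] at h
  exact h

lemma mkAlgHom_apply (a : R) :
    RingQuot.mkAlgHom k (fun a b : R => a ∈ s ∧ b = 0) a = QuotientBy.mk s a :=
  RingHom.congr_fun (RingQuot.mkAlgHom_coe k _) a

lemma mk_smul (t : k) (a : R) : QuotientBy.mk s (t • a) = t • QuotientBy.mk s a := by
  rw [← mkAlgHom_apply (k := k), ← mkAlgHom_apply (k := k), map_smul]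

variable (k) in
/-- An algebra homomorphism that kills `s` factors through `R / (s)`. -/
noncomputable def liftAlg {A : Type w} [Ring A] [Algebra k A] (f : R →ₐ[k] A)
    (hf : ∀ a ∈ s, f a = 0) : QuotientBy s →ₐ[k] A :=
  RingQuot.liftAlgHom k ⟨f, fun a b h => by rw [hf a h.1, h.2, map_zero]⟩

lemma liftAlg_mk {A : Type w} [Ring A] [Algebra k A] (f : R →ₐ[k] A)
    (hf : ∀ a ∈ s, f a = 0) (a : R) : liftAlg k f hf (QuotientBy.mk s a) = f a := by
  rw [← mkAlgHom_apply (k := k)]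
  exact RingQuot.liftAlgHom_mkAlgHom_apply k f _ a

lemma algHom_ext {A : Type w} [Ring A] [Algebra k A] {f g : QuotientBy s →ₐ[k] A}
    (h : ∀ a, f (QuotientBy.mk s a) = g (QuotientBy.mk s a)) : f = g := by
  refine RingQuot.ringQuot_ext' k f g (AlgHom.ext fun a => ?_)
  have := h a
  rw [← mkAlgHom_apply (k := k)] at this
  exact this

end QuotientBy

variable {k : Type u} [Field k]

namespace QuantumPlane

variable {lam : k}

lemma x_mul_y : x k lam * y k lam = lam • (y k lam * x k lam) := by
  have h := QuotientBy.mk_eq_zero (s := ({FreeAlgebra.ι k 0 * FreeAlgebra.ι k 1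
    - lam • (FreeAlgebra.ι k 1 * FreeAlgebra.ι k 0)} : Set (FreeAlgebra k (Fin 2)))) rfl
  rw [map_sub, QuotientBy.mk_smul, map_mul, map_mul, sub_eq_zero] at h
  exact h

/-- The homomorphism out of the quantum plane given by two elements. -/
noncomputable def lift {A : Type v} [Ring A] [Algebra k A] (a b : A) (h : a * b = lam • (b * a)) :
    QuantumPlane k lam →ₐ[k] A :=
  QuotientBy.liftAlg k (FreeAlgebra.lift k ![a, b]) (by
    rintro _ rfl
    simp [h])

lemma lift_x {A : Type v} [Ring A] [Algebra k A] (a b : A) (h : a * b = lam • (b * a)) :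
    lift a b h (x k lam) = a := by
  rw [lift, x, QuotientBy.liftAlg_mk]
  simp

lemma lift_y {A : Type v} [Ring A] [Algebra k A] (a b : A) (h : a * b = lam • (b * a)) :
    lift a b h (y k lam) = b := by
  rw [lift, y, QuotientBy.liftAlg_mk]
  simp

lemma algHom_ext {A : Type v} [Ring A] [Algebra k A] {f g : QuantumPlane k lam →ₐ[k] A}
    (hx : f (x k lam) = g (x k lam)) (hy : f (y k lam) = g (y k lam)) : f = g := by
  refine RingQuot.ringQuot_ext' k f g (FreeAlgebra.hom_ext (funext fun i => ?_))
  have h : ∀ F : QuantumPlane k lam →ₐ[k] A, ∀ i, F (RingQuot.mkAlgHom k _ (FreeAlgebra.ι k i))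
    = F (QuotientBy.mk _ (FreeAlgebra.ι k i)) := fun F i =>
      congrArg F (QuotientBy.mkAlgHom_apply _)
  change f (RingQuot.mkAlgHom k _ (FreeAlgebra.ι k i)) =
    g (RingQuot.mkAlgHom k _ (FreeAlgebra.ι k i))
  rw [h f i, h g i]
  fin_cases i
  · exact hx
  · exact hy

/-- A quotient of the quantum plane where `x² = 0` and `y² = s yx` is given by a form. -/
lemma nonempty_equiv_formAlg (s : k) {S : Set (QuantumPlane k lam)}
    (hx : QuotientBy.mk S (x k lam ^ 2) = 0)
    (hy : QuotientBy.mk S (y k lam ^ 2) = s • QuotientBy.mk S (y k lam * x k lam))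
    (hyx : QuotientBy.mk S (y k lam * x k lam * y k lam) = 0)
    (hS : ∀ f : QuantumPlane k lam →ₐ[k] FormAlg 0 lam 1 s,
      f (x k lam) = FormAlg.mk 0 1 0 0 → f (y k lam) = FormAlg.mk 0 0 1 0 → ∀ a ∈ S, f a = 0) :
    Nonempty (QuotientBy S ≃ₐ[k] FormAlg 0 lam 1 s) := by
  set X := QuotientBy.mk S (x k lam) with hX
  set Y := QuotientBy.mk S (y k lam) with hY
  have hXY : X * Y = lam • (Y * X) := by
    rw [hX, hY, ← map_mul, x_mul_y, QuotientBy.mk_smul, map_mul]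
  have hXX : X * X = 0 := by rw [← hx, map_pow, sq]
  have hYY : Y * Y = s • (Y * X) := by
    rw [hY, hX, ← map_mul, ← map_mul, ← sq, hy]
  have hYXY : Y * X * Y = 0 := by rw [← map_mul, ← map_mul, hyx]
  have hXYX : X * (Y * X) = 0 := by
    rw [← mul_assoc, hXY, smul_mul_assoc, mul_assoc, hXX, mul_zero, smul_zero]
  have hYYX : Y * (Y * X) = 0 := by
    rw [← mul_assoc, hYY, smul_mul_assoc, mul_assoc, hXX, mul_zero, smul_zero]
  have hYXX : Y * X * X = 0 := by rw [mul_assoc, hXX, mul_zero]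
  -- The basis vector `z` is realized by `yx`, which is why the third structure constant is 1.
  let F : FormAlg 0 lam 1 s →ₐ[k] QuotientBy S :=
    FormAlg.lift X Y (Y * X) (by rw [hXX, zero_smul]) hXY (one_smul _ _).symm hYY
      hXYX hYXX hYYX hYXY (by rw [← mul_assoc, hYXY, zero_mul])
  let g : QuantumPlane k lam →ₐ[k] FormAlg 0 lam 1 s :=
    lift (FormAlg.mk 0 1 0 0) (FormAlg.mk 0 0 1 0) (by
      simp [FormAlg.mk_mul, FormAlg.smul_mk])
  have hgx : g (x k lam) = FormAlg.mk 0 1 0 0 := lift_x _ _ _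
  have hgy : g (y k lam) = FormAlg.mk 0 0 1 0 := lift_y _ _ _
  let G : QuotientBy S →ₐ[k] FormAlg 0 lam 1 s := QuotientBy.liftAlg k g (hS g hgx hgy)
  have hGX : G X = FormAlg.mk 0 1 0 0 := (QuotientBy.liftAlg_mk g _ _).trans hgx
  have hGY : G Y = FormAlg.mk 0 0 1 0 := (QuotientBy.liftAlg_mk g _ _).trans hgy
  have hF : ∀ a b c d : k,
      F (FormAlg.mk a b c d) = a • (1 : QuotientBy S) + b • X + c • Y + d • (Y * X) :=
    fun a b c d => rfl
  refine ⟨AlgEquiv.ofAlgHom G F (AlgHom.ext fun u => ?_) (QuotientBy.algHom_ext fun a => ?_)⟩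
  · obtain ⟨a, b, c, d, rfl⟩ := FormAlg.mk_surj u
    rw [AlgHom.comp_apply, hF]
    simp [hGX, hGY, FormAlg.one_def, FormAlg.mk_mul, FormAlg.smul_mk, FormAlg.mk_add]
  · have key : (F.comp G).comp (RingQuot.mkAlgHom k _) = (RingQuot.mkAlgHom k _) := by
      refine algHom_ext ?_ ?_
      · change F (G (RingQuot.mkAlgHom k _ _)) = RingQuot.mkAlgHom k _ _
        rw [QuotientBy.mkAlgHom_apply, ← hX, hGX, hF]
        simp
      · change F (G (RingQuot.mkAlgHom k _ _)) = RingQuot.mkAlgHom k _ _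
        rw [QuotientBy.mkAlgHom_apply, ← hY, hGY, hF]
        simp
    have := AlgHom.congr_fun key a
    rw [AlgHom.comp_apply, QuotientBy.mkAlgHom_apply] at this
    exact this

end QuantumPlane

variable (k) in
lemma nonempty_skewSquares_equiv (lam : k) :
    Nonempty (SkewSquares k lam ≃ₐ[k] FormAlg 0 lam 1 0) := by
  have hx : QuotientBy.mk ({QuantumPlane.x k lam ^ 2, QuantumPlane.y k lam ^ 2} :
    Set (QuantumPlane k lam)) (QuantumPlane.x k lam ^ 2) = 0 := QuotientBy.mk_eq_zero (by simp)
  have hy : QuotientBy.mk ({QuantumPlane.x k lam ^ 2, QuantumPlane.y k lam ^ 2} :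
    Set (QuantumPlane k lam)) (QuantumPlane.y k lam ^ 2) = 0 := QuotientBy.mk_eq_zero (by simp)
  refine QuantumPlane.nonempty_equiv_formAlg 0 hx (by rw [hy, zero_smul]) ?_ ?_
  · rw [mul_assoc, QuantumPlane.x_mul_y, mul_smul_comm, ← mul_assoc, ← sq, QuotientBy.mk_smul,
      map_mul, hy, zero_mul, smul_zero]
  · rintro f hfx hfy a (rfl | rfl)
    · rw [map_pow, hfx, sq, FormAlg.mk_mul, FormAlg.zero_def, FormAlg.mk_inj]
      simp
    · rw [map_pow, hfy, sq, FormAlg.mk_mul, FormAlg.zero_def, FormAlg.mk_inj]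
      simp

variable (k) in
lemma nonempty_skewJordan_equiv :
    Nonempty (SkewJordan k ≃ₐ[k] FormAlg (0 : k) (-1) 1 (-1)) := by
  set S := ({QuantumPlane.x k (-1) ^ 2,
    QuantumPlane.y k (-1) ^ 2 + QuantumPlane.y k (-1) * QuantumPlane.x k (-1)} :
    Set (QuantumPlane k (-1)))
  have hx : QuotientBy.mk S (QuantumPlane.x k (-1) ^ 2) = 0 := QuotientBy.mk_eq_zero (by simp [S])
  have hy : QuotientBy.mk S (QuantumPlane.y k (-1) ^ 2 + QuantumPlane.y k (-1) *
    QuantumPlane.x k (-1)) = 0 := QuotientBy.mk_eq_zero (by simp [S])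
  rw [map_add] at hy
  have hy' := eq_neg_of_add_eq_zero_left hy
  refine QuantumPlane.nonempty_equiv_formAlg (-1) hx (by rw [hy']; module) ?_ ?_
  -- Moving `x` to the right, `yxy = -y²x = yx²`, which vanishes because `x² = 0`.
  · have h1 : QuotientBy.mk S (QuantumPlane.y k (-1) * QuantumPlane.x k (-1)
        * QuantumPlane.x k (-1)) = 0 := by
      rw [mul_assoc, ← sq, map_mul, hx, mul_zero]
    have h3 : QuotientBy.mk S (QuantumPlane.x k (-1) * (QuantumPlane.y k (-1)
        * QuantumPlane.x k (-1))) = 0 := by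
      rw [← mul_assoc, QuantumPlane.x_mul_y, smul_mul_assoc, QuotientBy.mk_smul, h1, smul_zero]
    have h2 : QuotientBy.mk S (QuantumPlane.y k (-1) * (QuantumPlane.y k (-1)
        * QuantumPlane.x k (-1))) = 0 := by
      rw [← mul_assoc, ← sq, map_mul, hy', map_mul, neg_mul, ← map_mul, ← map_mul, h1, neg_zero]
    have h4 : QuotientBy.mk S (QuantumPlane.y k (-1) * (QuantumPlane.x k (-1)
        * QuantumPlane.y k (-1))) = 0 := by
      rw [QuantumPlane.x_mul_y, mul_smul_comm, QuotientBy.mk_smul, h2, smul_zero]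
    rw [mul_assoc, h4]
  · rintro f hfx hfy a (rfl | rfl)
    · rw [map_pow, hfx, sq, FormAlg.mk_mul, FormAlg.zero_def, FormAlg.mk_inj]
      simp
    · rw [map_add, map_mul, map_pow, hfx, hfy, sq, FormAlg.mk_mul, FormAlg.mk_mul, FormAlg.mk_add,
        FormAlg.zero_def, FormAlg.mk_inj]
      simp

variable (k) in
lemma nonempty_commutativeSquares_equiv :
    Nonempty (CommutativeSquares k ≃ₐ[k] FormAlg (0 : k) 1 1 0) := by
  set I := Ideal.span ({MvPolynomial.X 0 ^ 2, MvPolynomial.X 1 ^ 2} :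
    Set (MvPolynomial (Fin 2) k)) with hI
  let X : CommutativeSquares k := Ideal.Quotient.mk I (MvPolynomial.X 0)
  let Y : CommutativeSquares k := Ideal.Quotient.mk I (MvPolynomial.X 1)
  have hXX : X * X = 0 := by
    rw [← map_mul, Ideal.Quotient.eq_zero_iff_mem, ← sq]
    exact Ideal.subset_span (by simp)
  have hYY : Y * Y = 0 := by
    rw [← map_mul, Ideal.Quotient.eq_zero_iff_mem, ← sq]
    exact Ideal.subset_span (by simp)
  let F : FormAlg (0 : k) 1 1 0 →ₐ[k] CommutativeSquares k :=
    FormAlg.lift X Y (Y * X) (by rw [hXX, zero_smul]) (by rw [one_smul, mul_comm])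
      (by rw [one_smul]) (by rw [hYY, zero_smul]) (by linear_combination Y * hXX)
      (by linear_combination Y * hXX) (by linear_combination X * hYY) (by linear_combination X * hYY)
      (by linear_combination X * X * hYY)
  have hcomm : ∀ u v : FormAlg (0 : k) 1 1 0, u * v = v * u := by
    intro u v
    obtain ⟨a, b, c, d, rfl⟩ := FormAlg.mk_surj u
    obtain ⟨a', b', c', d', rfl⟩ := FormAlg.mk_surj v
    simp only [FormAlg.mk_mul, FormAlg.mk_inj]
    refine ⟨?_, ?_, ?_, ?_⟩ <;> ring
  -- Evaluation of multivariate polynomials needs a commutative target.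
  let _ : CommRing (FormAlg (0 : k) 1 1 0) :=
    { (inferInstance : Ring (FormAlg (0 : k) 1 1 0)) with mul_comm := hcomm }
  let g : MvPolynomial (Fin 2) k →ₐ[k] FormAlg (0 : k) 1 1 0 :=
    MvPolynomial.aeval ![FormAlg.mk 0 1 0 0, FormAlg.mk 0 0 1 0]
  have hg0 : g (MvPolynomial.X 0) = FormAlg.mk 0 1 0 0 := by simp [g]
  have hg1 : g (MvPolynomial.X 1) = FormAlg.mk 0 0 1 0 := by simp [g]
  have hg : ∀ a ∈ I, g a = 0 := by
    intro a ha
    have : I ≤ RingHom.ker g := by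
      rw [hI, Ideal.span_le]
      rintro a (rfl | rfl)
      · rw [SetLike.mem_coe, RingHom.mem_ker, map_pow, hg0, sq, FormAlg.mk_mul, FormAlg.zero_def,
          FormAlg.mk_inj]
        simp
      · rw [SetLike.mem_coe, RingHom.mem_ker, map_pow, hg1, sq, FormAlg.mk_mul, FormAlg.zero_def,
          FormAlg.mk_inj]
        simp
    exact this ha
  let G : CommutativeSquares k →ₐ[k] FormAlg (0 : k) 1 1 0 := Ideal.Quotient.liftₐ I g hg
  have hGX : G X = FormAlg.mk 0 1 0 0 := hg0
  have hGY : G Y = FormAlg.mk 0 0 1 0 := hg1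
  have hF : ∀ a b c d : k,
      F (FormAlg.mk a b c d) = a • (1 : CommutativeSquares k) + b • X + c • Y + d • (Y * X) :=
    fun a b c d => rfl
  refine ⟨AlgEquiv.ofAlgHom G F (AlgHom.ext fun u => ?_) ?_⟩
  · obtain ⟨a, b, c, d, rfl⟩ := FormAlg.mk_surj u
    rw [AlgHom.comp_apply, hF]
    simp only [map_add, map_smul, map_mul, map_one, hGX, hGY]
    simp [FormAlg.one_def, FormAlg.mk_mul, FormAlg.smul_mk, FormAlg.mk_add]
  · refine Ideal.Quotient.algHom_ext k (MvPolynomial.algHom_ext fun i => ?_)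
    fin_cases i
    · change F (G X) = X
      rw [hGX, hF]
      simp
    · change F (G Y) = Y
      rw [hGY, hF]
      simp

end QuotientPresentations

/-! ### Matrices and the 2-cycle algebra as Peirce algebras -/

section PeircePresentations

variable {k : Type u} [Field k]

lemma PeirceAlg.lift_bijective {α : k} {A : Type v} [Ring A] [Algebra k A]
    (hA : Module.finrank k A = 4) (F : PeirceAlg α →ₐ[k] A) (hF : Function.Injective F) :
    Function.Bijective F := by
  have : Module.Finite k A := Module.finite_of_finrank_pos (by omega)
  exact ⟨hF, (LinearMap.injective_iff_surjective_of_finrank_eq_finrank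
    (PeirceAlg.finrank_eq.trans hA.symm) (f := F.toLinearMap)).1 hF⟩

variable (k) in
lemma nonempty_matrix_equiv {α : k} (hα : α ≠ 0) :
    Nonempty (Matrix (Fin 2) (Fin 2) k ≃ₐ[k] PeirceAlg α) := by
  -- Scaling one off-diagonal matrix unit by `α` produces `xy = αe` and `yx = αf`. It stays
  -- injective because `α ≠ 0`.
  let F : PeirceAlg α →ₐ[k] Matrix (Fin 2) (Fin 2) k :=
    PeirceAlg.lift !![1, 0; 0, 0] !![0, 0; 0, 1] !![0, α; 0, 0] !![0, 0; 1, 0]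
      (by simp [Matrix.one_fin_two])
      (by ext i j; fin_cases i <;> fin_cases j <;> simp)
      (by ext i j; fin_cases i <;> fin_cases j <;> simp)
      (by ext i j; fin_cases i <;> fin_cases j <;> simp)
      (by ext i j; fin_cases i <;> fin_cases j <;> simp)
      (by ext i j; fin_cases i <;> fin_cases j <;> simp)
      (by ext i j; fin_cases i <;> fin_cases j <;> simp)
      (by ext i j; fin_cases i <;> fin_cases j <;> simp)
      (by ext i j; fin_cases i <;> fin_cases j <;> simp)
  have hF : Function.Injective F := by
    rw [injective_iff_map_eq_zero]
    intro u hu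
    obtain ⟨a, b, c, d, rfl⟩ := PeirceAlg.mk_surj u
    have h : a • (!![1, 0; 0, 0] : Matrix (Fin 2) (Fin 2) k) + b • !![0, 0; 0, 1]
      + c • !![0, α; 0, 0] + d • !![0, 0; 1, 0] = 0 := hu
    have h00 := congrFun (congrFun h 0) 0
    have h01 := congrFun (congrFun h 0) 1
    have h10 := congrFun (congrFun h 1) 0
    have h11 := congrFun (congrFun h 1) 1
    simp [hα] at h00 h01 h10 h11
    rw [h00, h01, h10, h11, PeirceAlg.zero_def]
  exact ⟨(AlgEquiv.ofBijective F (PeirceAlg.lift_bijective (by simp [Module.finrank_matrix]) F hF)).symm⟩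

namespace PathAlgebra

variable (k) in
/-- The trivial path at a vertex. -/
noncomputable def ofVertex {V : Type v} [Quiver.{w} V] [Fintype V] (a : V) : PathAlgebra k V :=
  RingQuot.mkAlgHom k (PathRelation k V) (FreeAlgebra.ι k (.vertex a))

variable {V : Type v} [Quiver.{w} V] [Fintype V]

lemma ofVertex_mul_of_ne {a b : V} (h : a ≠ b) : ofVertex k a * ofVertex k b = 0 := by
  have := RingQuot.mkAlgHom_rel k (PathRelation.orthogonal (k := k) a b h)
  rwa [map_mul, map_zero] at this

lemma sum_ofVertex : ∑ a : V, ofVertex k a = 1 := by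
  have := RingQuot.mkAlgHom_rel k (PathRelation.complete (k := k) (V := V))
  rwa [map_sum, map_one] at this

lemma ofVertex_mul_ofArrow {a b : V} (f : a ⟶ b) : ofVertex k a * ofArrow k f = ofArrow k f := by
  have := RingQuot.mkAlgHom_rel k (PathRelation.source (k := k) f)
  rwa [map_mul] at this

lemma ofArrow_mul_ofVertex {a b : V} (f : a ⟶ b) : ofArrow k f * ofVertex k b = ofArrow k f := by
  have := RingQuot.mkAlgHom_rel k (PathRelation.target (k := k) f)
  rwa [map_mul] at this

end PathAlgebra

namespace TwoCycle

/-- The images of the generators of the path algebra of the 2-cycle quiver. -/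
def generatorImage : PathGenerator TwoCycle → PeirceAlg (0 : k)
  | .vertex .one => PeirceAlg.mk 1 0 0 0
  | .vertex .two => PeirceAlg.mk 0 1 0 0
  | .arrow Arrow.x => PeirceAlg.mk 0 0 1 0
  | .arrow Arrow.y => PeirceAlg.mk 0 0 0 1

lemma sum_univ {M : Type v} [AddCommMonoid M] (f : TwoCycle → M) :
    ∑ a, f a = f one + f two := by
  have h : (Finset.univ : Finset TwoCycle) = ⟨{one, two}, by simp⟩ := rfl
  rw [h, Finset.sum_mk]
  simp

variable (k) in
lemma nonempty_twoCycleAlgebra_equiv : Nonempty (TwoCycleAlgebra k ≃ₐ[k] PeirceAlg (0 : k)) := by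
  set S := ({TwoCycle.x k * TwoCycle.y k, TwoCycle.y k * TwoCycle.x k} :
    Set (PathAlgebra k TwoCycle)) with hS
  let π := QuotientBy.mk S
  let g : PathAlgebra k TwoCycle →ₐ[k] PeirceAlg (0 : k) :=
    RingQuot.liftAlgHom k ⟨FreeAlgebra.lift k generatorImage, by
      intro a b h
      induction h with
      | idempotent a => cases a <;> simp [generatorImage, PeirceAlg.mk_mul]
      | orthogonal a b h =>
        cases a <;> cases b <;>
          simp_all [generatorImage, PeirceAlg.mk_mul, PeirceAlg.zero_def]
      | complete =>
        rw [sum_univ]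
        simp [generatorImage, PeirceAlg.mk_add, PeirceAlg.one_def]
      | @source a b f =>
        change Arrow a b at f
        cases f <;> simp [generatorImage, PeirceAlg.mk_mul]
      | @target a b f =>
        change Arrow a b at f
        cases f <;> simp [generatorImage, PeirceAlg.mk_mul]⟩
  have hgen : ∀ i, g (RingQuot.mkAlgHom k _ (FreeAlgebra.ι k i)) = generatorImage i := by
    intro i
    refine (RingQuot.liftAlgHom_mkAlgHom_apply k _ _ _).trans ?_
    simp
  have hgx : g (x k) = PeirceAlg.mk 0 0 1 0 := hgen _
  have hgy : g (y k) = PeirceAlg.mk 0 0 0 1 := hgen _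
  let G : TwoCycleAlgebra k →ₐ[k] PeirceAlg (0 : k) := QuotientBy.liftAlg k g (by
    rintro a (rfl | rfl)
    · rw [map_mul, hgx, hgy, PeirceAlg.mk_mul, PeirceAlg.zero_def, PeirceAlg.mk_inj]
      simp
    · rw [map_mul, hgx, hgy, PeirceAlg.mk_mul, PeirceAlg.zero_def, PeirceAlg.mk_inj]
      simp)
  have hG : ∀ a, G (π a) = g a := fun a => QuotientBy.liftAlg_mk g _ a
  let F : PeirceAlg (0 : k) →ₐ[k] TwoCycleAlgebra k :=
    PeirceAlg.lift (π (PathAlgebra.ofVertex k one)) (π (PathAlgebra.ofVertex k two))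
      (π (x k)) (π (y k))
      (by rw [← map_add, ← sum_univ, PathAlgebra.sum_ofVertex, map_one])
      (by rw [← map_mul, PathAlgebra.ofVertex_mul_of_ne (by simp), map_zero])
      (by rw [← map_mul, PathAlgebra.ofVertex_mul_of_ne (by simp), map_zero])
      (by rw [← map_mul, x, PathAlgebra.ofVertex_mul_ofArrow])
      (by rw [← map_mul, x, PathAlgebra.ofArrow_mul_ofVertex])
      (by rw [← map_mul, y, PathAlgebra.ofVertex_mul_ofArrow])
      (by rw [← map_mul, y, PathAlgebra.ofArrow_mul_ofVertex])
      (by rw [← map_mul, zero_smul]; exact QuotientBy.mk_eq_zero (by simp [hS]))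
      (by rw [← map_mul, zero_smul]; exact QuotientBy.mk_eq_zero (by simp [hS]))
  have hF : ∀ a b c d : k, F (PeirceAlg.mk a b c d) = a • π (PathAlgebra.ofVertex k one)
      + b • π (PathAlgebra.ofVertex k two) + c • π (x k) + d • π (y k) := fun a b c d => rfl
  refine ⟨AlgEquiv.ofAlgHom G F (AlgHom.ext fun u => ?_) (QuotientBy.algHom_ext fun a => ?_)⟩
  · obtain ⟨a, b, c, d, rfl⟩ := PeirceAlg.mk_surj u
    rw [AlgHom.comp_apply, hF]
    simp only [map_add, map_smul, hG, hgx, hgy]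
    rw [PathAlgebra.ofVertex, PathAlgebra.ofVertex, hgen, hgen]
    simp [generatorImage, PeirceAlg.smul_mk, PeirceAlg.mk_add]
  · have key : ((F.comp G).comp (RingQuot.mkAlgHom k _)).comp (RingQuot.mkAlgHom k _) =
        ((RingQuot.mkAlgHom k (fun a b : PathAlgebra k TwoCycle => a ∈ S ∧ b = 0)).comp
          (RingQuot.mkAlgHom k (PathRelation k TwoCycle))) := by
      refine FreeAlgebra.hom_ext (funext fun i => ?_)
      change F (G (RingQuot.mkAlgHom k _ (RingQuot.mkAlgHom k _ (FreeAlgebra.ι k i))))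
        = RingQuot.mkAlgHom k _ (RingQuot.mkAlgHom k _ (FreeAlgebra.ι k i))
      rw [QuotientBy.mkAlgHom_apply]
      refine (congrArg F ((hG _).trans (hgen i))).trans ?_
      rcases i with (_ | _) | f
      · simp [generatorImage, hF, PathAlgebra.ofVertex, π]
        rfl
      · simp [generatorImage, hF, PathAlgebra.ofVertex, π]
        rfl
      · rename_i a b
        change Arrow a b at f
        cases f <;> simp [generatorImage, hF, π] <;> rfl
    obtain ⟨a, rfl⟩ := RingQuot.mkAlgHom_surjective k _ a
    have := AlgHom.congr_fun key a
    simp only [AlgHom.comp_apply, QuotientBy.mkAlgHom_apply] at this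
    exact this

end TwoCycle

end PeircePresentations

/-! ### Bilinear forms on a plane up to congruence and scaling -/

section FormNormalForms

variable {k : Type u} [Field k]

namespace FormAlg

/-- Congruent forms give isomorphic algebras. -/
lemma nonempty_equiv_of_congruent {p q r s p' q' r' s' : k} (a b c d t : k) (ht : t ≠ 0)
    (hdet : a * d - b * c ≠ 0)
    (hp : p * a * a + q * a * b + r * b * a + s * b * b = p' * t)
    (hq : p * a * c + q * a * d + r * b * c + s * b * d = q' * t)
    (hr : p * c * a + q * c * b + r * d * a + s * d * b = r' * t)
    (hs : p * c * c + q * c * d + r * d * c + s * d * d = s' * t) :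
    Nonempty (FormAlg p q r s ≃ₐ[k] FormAlg p' q' r' s') := by
  let F : FormAlg p' q' r' s' →ₐ[k] FormAlg p q r s :=
    lift (mk 0 a b 0) (mk 0 c d 0) (mk 0 0 0 t)
      (by simp [mk_mul, smul_mk, hp]) (by simp [mk_mul, smul_mk, hq])
      (by simp [mk_mul, smul_mk, hr]) (by simp [mk_mul, smul_mk, hs])
      (by simp [mk_mul, zero_def]) (by simp [mk_mul, zero_def]) (by simp [mk_mul, zero_def])
      (by simp [mk_mul, zero_def]) (by simp [mk_mul, zero_def])
  have hF : Function.Injective F := by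
    rw [injective_iff_map_eq_zero]
    intro u hu
    obtain ⟨α, β, γ, δ, rfl⟩ := mk_surj u
    have h : α • mk 1 0 0 0 + β • mk 0 a b 0 + γ • mk 0 c d 0 + δ • mk 0 0 0 t
      = (0 : FormAlg p q r s) := hu
    simp only [smul_mk, mk_add, zero_def, mk_inj] at h ⊢
    obtain ⟨h1, h2, h3, h4⟩ := h
    refine ⟨by linear_combination h1, ?_, ?_, ?_⟩
    · refine (mul_eq_zero.1 (?_ : (a * d - b * c) * β = 0)).resolve_left hdet
      linear_combination d * h2 - c * h3
    · refine (mul_eq_zero.1 (?_ : (a * d - b * c) * γ = 0)).resolve_left hdet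
      linear_combination a * h3 - b * h2
    · refine (mul_eq_zero.1 (?_ : t * δ = 0)).resolve_left ht
      linear_combination h4
  exact ⟨(AlgEquiv.ofBijective F ⟨hF, (LinearMap.injective_iff_surjective_of_finrank_eq_finrank
    (finrank_eq.trans finrank_eq.symm) (f := F.toLinearMap)).1 hF⟩).symm⟩

/-- Over an algebraically closed field a nondegenerate form has an isotropic vector, so that it is
congruent to a form with vanishing first entry. -/
lemma exists_isotropic [IsAlgClosed k] {p q r s : k} (h : p * s - q * r ≠ 0) :
    ∃ q' s' : k, q' ≠ 0 ∧ Nonempty (FormAlg p q r s ≃ₐ[k] FormAlg 0 q' 1 s') := by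
  obtain ⟨a, b, hab, h0⟩ : ∃ a b : k, (a ≠ 0 ∨ b ≠ 0) ∧
      p * a * a + q * a * b + r * b * a + s * b * b = 0 := by
    -- For `p = 0` the first basis vector is isotropic. Otherwise the vector `(z, 1)` is isotropic
    -- for a root `z` of the quadratic form.
    by_cases hp : p = 0
    · exact ⟨1, 0, by simp, by simp [hp]⟩
    · obtain ⟨z, hz⟩ := IsAlgClosed.exists_root (C p * X ^ 2 + C (q + r) * X + C s)
        (by rw [degree_quadratic hp]; decide)
      refine ⟨z, 1, by simp, ?_⟩
      simp only [IsRoot.def, eval_add, eval_mul, eval_C, eval_pow, eval_X] at hz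
      linear_combination hz
  obtain ⟨c, d, hdet⟩ : ∃ c d : k, a * d - b * c ≠ 0 := by
    rcases hab with ha | hb
    · exact ⟨0, 1, by simpa using ha⟩
    · exact ⟨1, 0, by simpa using hb⟩
  set Q := p * a * c + q * a * d + r * b * c + s * b * d with hQ
  set R := p * c * a + q * c * b + r * d * a + s * d * b with hR
  set S := p * c * c + q * c * d + r * d * c + s * d * d with hS
  -- Congruence multiplies the determinant by the square of that of the base change. With first
  -- entry 0 the new determinant is `-QR`, so neither `Q` nor `R` vanishes.
  have hprod : Q * R = - ((a * d - b * c) ^ 2 * (p * s - q * r)) := by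
    rw [hQ, hR]
    linear_combination (p * c * c + q * c * d + r * d * c + s * d * d) * h0
  have hne : Q * R ≠ 0 := by
    rw [hprod]
    exact neg_ne_zero.2 (mul_ne_zero (pow_ne_zero _ hdet) h)
  have hQ0 : Q ≠ 0 := left_ne_zero_of_mul hne
  have hR0 : R ≠ 0 := right_ne_zero_of_mul hne
  refine ⟨Q / R, S / R, div_ne_zero hQ0 hR0,
    nonempty_equiv_of_congruent a b c d R hR0 hdet ?_ ?_ ?_ ?_⟩
  · rw [h0, zero_mul]
  · rw [div_mul_cancel₀ _ hR0]
  · rw [one_mul]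
  · rw [div_mul_cancel₀ _ hR0]

/-- The normal forms of a nondegenerate form up to congruence and scaling. -/
lemma exists_normal_form [IsAlgClosed k] [CharZero k] {p q r s : k} (h : p * s - q * r ≠ 0) :
    Nonempty (FormAlg p q r s ≃ₐ[k] FormAlg (0 : k) (-1) 1 (-1)) ∨
      ∃ lam : k, lam ≠ 0 ∧ Nonempty (FormAlg p q r s ≃ₐ[k] FormAlg 0 lam 1 0) := by
  obtain ⟨lam, s', hlam, ⟨e⟩⟩ := exists_isotropic h
  -- A shear `y ↦ y + cx` changes the last entry by `c(λ + 1)`. For `λ = -1` it has no effect and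
  -- only rescaling is left, so `s' = 0` and `s' ≠ 0` are different cases.
  by_cases h1 : lam = -1
  · by_cases hs : s' = 0
    · subst hs
      exact Or.inr ⟨lam, hlam, ⟨e⟩⟩
    · left
      subst h1
      obtain ⟨e'⟩ := nonempty_equiv_of_congruent (p := 0) (q := -1) (r := 1) (s := s') (p' := 0)
        (q' := -1) (r' := 1) (s' := -1) (-s') 0 0 1 (-s') (neg_ne_zero.2 hs)
        (by simpa using hs) (by ring) (by ring) (by ring) (by ring)
      exact ⟨e.trans e'⟩
  · right
    have h2 : lam + 1 ≠ 0 := fun h => h1 (eq_neg_of_add_eq_zero_left h)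
    obtain ⟨e'⟩ := nonempty_equiv_of_congruent (p := 0) (q := lam) (r := 1) (s := s') (p' := 0)
        (q' := lam) (r' := 1) (s' := 0) 1 0 (-s' / (lam + 1)) 1 1 one_ne_zero
        (by simp) (by ring) (by ring) (by ring) (by field_simp; ring)
    exact ⟨lam, hlam, ⟨e.trans e'⟩⟩

/-- Exchanging `x` and `y` turns the pair of products `(λz, z)` into `(z, λz)`. Rescaling `z` by `λ`
normalizes the second to 1. -/
lemma nonempty_equiv_inv {lam : k} (h : lam ≠ 0) :
    Nonempty (FormAlg 0 lam 1 0 ≃ₐ[k] FormAlg 0 lam⁻¹ 1 0) :=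
  nonempty_equiv_of_congruent 0 1 1 0 lam h (by simp) (by ring) (by field_simp; ring) (by ring)
    (by ring)

end FormAlg

end FormNormalForms

/-! ### Frobenius functionals -/

section Frobenius

variable {k : Type u} [Field k]

/-- A linear functional whose kernel contains no nonzero one-sided ideal makes an algebra
Frobenius. -/
lemma IsFrobeniusAlgebra.of_functional {R : Type v} [Ring R] [Algebra k R] [Module.Finite k R]
    (φ : R →ₗ[k] k) (h : ∀ a : R, a ≠ 0 → ∃ b c : R, φ (a * b) ≠ 0 ∧ φ (c * a) ≠ 0) :
    IsFrobeniusAlgebra k R :=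
  ⟨inferInstance, (LinearMap.mul k R).compr₂ φ, fun a b c => by simp [mul_assoc], h⟩

lemma IsFrobeniusAlgebra.exists_functional {R : Type v} [Ring R] [Algebra k R]
    (h : IsFrobeniusAlgebra k R) :
    ∃ φ : R →ₗ[k] k, ∀ a : R, a ≠ 0 → (∃ b, φ (a * b) ≠ 0) ∧ ∃ c, φ (c * a) ≠ 0 := by
  obtain ⟨B, hB, hnd⟩ := h.exists_form
  have hφ : ∀ a b, B 1 (a * b) = B a b := fun a b => by rw [← hB, one_mul]
  refine ⟨B 1, fun a ha => ?_⟩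
  obtain ⟨b, c, hb, hc⟩ := hnd a ha
  exact ⟨⟨b, by rwa [hφ]⟩, ⟨c, by rwa [hφ]⟩⟩

lemma IsFrobeniusAlgebra.of_equiv {R : Type v} {S : Type w} [Ring R] [Algebra k R] [Ring S]
    [Algebra k S] (e : R ≃ₐ[k] S) (h : IsFrobeniusAlgebra k R) : IsFrobeniusAlgebra k S := by
  have := h.finite
  have : Module.Finite k S := Module.Finite.equiv e.toLinearEquiv
  obtain ⟨φ, hφ⟩ := h.exists_functional
  refine .of_functional (φ ∘ₗ e.symm.toLinearMap) fun a ha => ?_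
  obtain ⟨⟨b, hb⟩, ⟨c, hc⟩⟩ := hφ (e.symm a) (by simpa using ha)
  exact ⟨e b, e c, by simpa using hb, by simpa using hc⟩

/-- The functional is the coefficient of `z`. Pairing with `1` and `z` detects the coefficients of
`z` and `1`, and pairing with `x` and `y` is a linear system of determinant `ps - qr`, solved by
Cramer's rule. -/
lemma FormAlg.isFrobeniusAlgebra {p q r s : k} (h : p * s - q * r ≠ 0) :
    IsFrobeniusAlgebra k (FormAlg p q r s) := by
  let φ : FormAlg p q r s →ₗ[k] k :=
    { toFun := fun u => u.2.2.2
      map_add' := fun _ _ => rfl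
      map_smul' := fun _ _ => rfl }
  have hφ : ∀ a b c d : k, φ (mk a b c d) = d := fun _ _ _ _ => rfl
  refine .of_functional φ fun u hu => ?_
  obtain ⟨a, b, c, d, rfl⟩ := mk_surj u
  have key : (∃ v, φ (mk a b c d * v) ≠ 0) ∧ ∃ v, φ (v * mk a b c d) ≠ 0 := by
    constructor
    · by_contra! H
      have h1 := H (mk 1 0 0 0)
      have h2 := H (mk 0 1 0 0)
      have h3 := H (mk 0 0 1 0)
      have h4 := H (mk 0 0 0 1)
      simp only [mk_mul, hφ, mul_one, mul_zero, add_zero, zero_add] at h1 h2 h3 h4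
      have hb := (mul_eq_zero.1 (by linear_combination s * h2 - r * h3 :
        (p * s - q * r) * b = 0)).resolve_left h
      have hc := (mul_eq_zero.1 (by linear_combination p * h3 - q * h2 :
        (p * s - q * r) * c = 0)).resolve_left h
      exact hu (by rw [h1, hb, hc, h4, zero_def])
    · by_contra! H
      have h1 := H (mk 1 0 0 0)
      have h2 := H (mk 0 1 0 0)
      have h3 := H (mk 0 0 1 0)
      have h4 := H (mk 0 0 0 1)
      simp only [mk_mul, hφ, one_mul, mul_one, zero_mul, mul_zero, add_zero, zero_add]
        at h1 h2 h3 h4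
      have hb := (mul_eq_zero.1 (by linear_combination s * h2 - q * h3 :
        (p * s - q * r) * b = 0)).resolve_left h
      have hc := (mul_eq_zero.1 (by linear_combination p * h3 - r * h2 :
        (p * s - q * r) * c = 0)).resolve_left h
      exact hu (by rw [h1, hb, hc, h4, zero_def])
  obtain ⟨⟨v, hv⟩, w, hw⟩ := key
  exact ⟨v, w, hv, hw⟩

/-- The sum of the two arrow coefficients works uniformly in `α`: multiplying by the four basis
elements on either side isolates the four coordinates. -/
lemma PeirceAlg.isFrobeniusAlgebra (α : k) : IsFrobeniusAlgebra k (PeirceAlg α) := by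
  let φ : PeirceAlg α →ₗ[k] k :=
    { toFun := fun u => u.2.2.1 + u.2.2.2
      map_add' := fun _ _ => add_add_add_comm _ _ _ _
      map_smul' := fun _ _ => (mul_add _ _ _).symm }
  have hφ : ∀ a b c d : k, φ (mk a b c d) = c + d := fun _ _ _ _ => rfl
  refine .of_functional φ fun u hu => ?_
  obtain ⟨a, b, c, d, rfl⟩ := mk_surj u
  have key : (∃ v, φ (mk a b c d * v) ≠ 0) ∧ ∃ v, φ (v * mk a b c d) ≠ 0 := by
    constructor
    · by_contra! H
      have h1 := H (mk 1 0 0 0)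
      have h2 := H (mk 0 1 0 0)
      have h3 := H (mk 0 0 1 0)
      have h4 := H (mk 0 0 0 1)
      simp [mk_mul, hφ] at h1 h2 h3 h4
      exact hu (by rw [h1, h2, h3, h4, zero_def])
    · by_contra! H
      have h1 := H (mk 1 0 0 0)
      have h2 := H (mk 0 1 0 0)
      have h3 := H (mk 0 0 1 0)
      have h4 := H (mk 0 0 0 1)
      simp [mk_mul, hφ] at h1 h2 h3 h4
      exact hu (by rw [h1, h2, h3, h4, zero_def])
  obtain ⟨⟨v, hv⟩, w, hw⟩ := key
  exact ⟨v, w, hv, hw⟩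

/-- The functional reads the top coefficient, in degree `deg p - 1`, of the remainder modulo `p`. A
suitable power of `X` moves the leading coefficient of a nonzero remainder to that place without any
further reduction. -/
lemma AdjoinRoot.isFrobeniusAlgebra {p : k[X]} (hp : p.Monic) :
    IsFrobeniusAlgebra k (AdjoinRoot p) := by
  have : Module.Finite k (AdjoinRoot p) := hp.finite_adjoinRoot
  let φ : AdjoinRoot p →ₗ[k] k := lcoeff k (p.natDegree - 1) ∘ₗ AdjoinRoot.modByMonicHom hp
  have key : ∀ a : AdjoinRoot p, a ≠ 0 → ∃ b, φ (a * b) ≠ 0 := by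
    intro a ha
    obtain ⟨q, rfl⟩ := AdjoinRoot.mk_surjective a
    set q' := q %ₘ p with hq'
    have hmk : AdjoinRoot.mk p q = AdjoinRoot.mk p q' := by
      rw [AdjoinRoot.mk_eq_mk]
      exact ⟨q /ₘ p, by linear_combination -modByMonic_add_div q p⟩
    have hne : q' ≠ 0 := by
      rintro h
      rw [hmk, h, map_zero] at ha
      exact ha rfl
    have hdeg : q'.natDegree < p.natDegree := by
      refine natDegree_modByMonic_lt q hp ?_
      rintro rfl
      exact hne (by rw [hq', modByMonic_one])
    refine ⟨AdjoinRoot.mk p (X ^ (p.natDegree - 1 - q'.natDegree)), ?_⟩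
    rw [hmk, ← map_mul]
    simp only [φ, LinearMap.comp_apply, AdjoinRoot.modByMonicHom_mk]
    rw [(modByMonic_eq_self_iff hp).2]
    · have : p.natDegree - 1 = q'.natDegree + (p.natDegree - 1 - q'.natDegree) := by omega
      rw [lcoeff_apply]
      nth_rewrite 2 [this]
      rw [coeff_mul_X_pow]
      simpa using hne
    · refine degree_lt_degree ?_
      rw [natDegree_mul_X_pow _ hne]
      omega
  refine .of_functional φ fun a ha => ?_
  obtain ⟨b, hb⟩ := key a ha
  exact ⟨b, b, hb, by rwa [mul_comm]⟩

end Frobenius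

/-! ### Algebras generated by one element and their minimal polynomials -/

section Monogenic

variable {k : Type u} [Field k]

variable (k) in
/-- An algebra is monogenic if it is generated by one element. -/
def IsMonogenic (A : Type v) [Ring A] [Algebra k A] : Prop :=
  ∃ a : A, Module.finrank k A ≤ (minpoly k a).natDegree

/-- Evaluation at `a` embeds the quotient of `k[X]` by the minimal polynomial, and the degree bound
forces this embedding to be onto. -/
lemma nonempty_adjoinRoot_minpoly_equiv {A : Type v} [Ring A] [Algebra k A] [Module.Finite k A]
    {a : A} (ha : Module.finrank k A ≤ (minpoly k a).natDegree) :
    Nonempty (AdjoinRoot (minpoly k a) ≃ₐ[k] A) := by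
  have hint : IsIntegral k a := Algebra.IsIntegral.isIntegral a
  have hm := minpoly.monic hint
  have : Module.Finite k (AdjoinRoot (minpoly k a)) := hm.finite_adjoinRoot
  let F : AdjoinRoot (minpoly k a) →ₐ[k] A :=
    Ideal.Quotient.liftₐ _ (aeval a) fun q hq => by
      rw [← minpoly.dvd_iff]
      exact Ideal.mem_span_singleton.1 hq
  have hF : Function.Injective F := by
    rw [injective_iff_map_eq_zero]
    intro q hq
    obtain ⟨q, rfl⟩ := AdjoinRoot.mk_surjective q
    have h : aeval a q = 0 := hq
    rwa [AdjoinRoot.mk_eq_zero, minpoly.dvd_iff]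
  have hrank : Module.finrank k (AdjoinRoot (minpoly k a)) = (minpoly k a).natDegree :=
    finrank_quotient_span_eq_natDegree
  have hle := LinearMap.finrank_le_finrank_of_injective (f := F.toLinearMap) hF
  exact ⟨AlgEquiv.ofBijective F ⟨hF, (LinearMap.injective_iff_surjective_of_finrank_eq_finrank
    (by omega) (f := F.toLinearMap)).1 hF⟩⟩

lemma nonempty_equiv_of_minpoly_eq {A : Type v} [Ring A] [Algebra k A] [Module.Finite k A]
    {B : Type w} [Ring B] [Algebra k B] [Module.Finite k B] {a : A} {b : B}
    (ha : Module.finrank k A ≤ (minpoly k a).natDegree)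
    (hb : Module.finrank k B ≤ (minpoly k b).natDegree) (h : minpoly k a = minpoly k b) :
    Nonempty (A ≃ₐ[k] B) := by
  obtain ⟨e⟩ := nonempty_adjoinRoot_minpoly_equiv ha
  obtain ⟨f⟩ := nonempty_adjoinRoot_minpoly_equiv hb
  rw [← h] at f
  exact ⟨e.symm.trans f⟩

lemma IsMonogenic.of_equiv {A : Type v} [Ring A] [Algebra k A] {B : Type w} [Ring B] [Algebra k B]
    (e : A ≃ₐ[k] B) (h : IsMonogenic k A) : IsMonogenic k B := by
  obtain ⟨a, ha⟩ := h
  refine ⟨e a, ?_⟩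
  rwa [minpoly.algEquiv_eq, ← e.toLinearEquiv.finrank_eq]

lemma IsMonogenic.isFrobeniusAlgebra {A : Type v} [Ring A] [Algebra k A] [Module.Finite k A]
    (h : IsMonogenic k A) : IsFrobeniusAlgebra k A := by
  obtain ⟨a, ha⟩ := h
  obtain ⟨e⟩ := nonempty_adjoinRoot_minpoly_equiv ha
  exact .of_equiv e (AdjoinRoot.isFrobeniusAlgebra (minpoly.monic (Algebra.IsIntegral.isIntegral a)))

/-- Translating by a scalar and translating back give divisibility in both directions between monic
polynomials. -/
lemma minpoly_add_algebraMap {A : Type v} [Ring A] [Algebra k A] [Module.Finite k A] (a : A)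
    (c : k) : minpoly k (a + algebraMap k A c) = (minpoly k a).comp (X - C c) := by
  have h1 : minpoly k (a + algebraMap k A c) ∣ (minpoly k a).comp (X - C c) := by
    rw [minpoly.dvd_iff, aeval_comp]
    simp
  have h2 : (minpoly k a).comp (X - C c) ∣ minpoly k (a + algebraMap k A c) := by
    have : minpoly k a ∣ (minpoly k (a + algebraMap k A c)).comp (X + C c) := by
      rw [minpoly.dvd_iff, aeval_comp]
      simp
    obtain ⟨q, hq⟩ := this
    refine ⟨q.comp (X - C c), ?_⟩
    have := congrArg (fun P => P.comp (X - C c)) hq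
    simpa [comp_assoc] using this
  exact eq_of_monic_of_associated (minpoly.monic (Algebra.IsIntegral.isIntegral _))
    ((minpoly.monic (Algebra.IsIntegral.isIntegral _)).comp_X_sub_C c)
    (associated_of_dvd_dvd h1 h2)

lemma minpoly_prod {A : Type v} [Ring A] [Algebra k A] [Module.Finite k A] {B : Type w} [Ring B]
    [Algebra k B] [Module.Finite k B] (a : A) (b : B)
    (h : IsCoprime (minpoly k a) (minpoly k b)) :
    minpoly k ((a, b) : A × B) = minpoly k a * minpoly k b := by
  refine eq_of_monic_of_associated (minpoly.monic (Algebra.IsIntegral.isIntegral _))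
    ((minpoly.monic (Algebra.IsIntegral.isIntegral _)).mul
      (minpoly.monic (Algebra.IsIntegral.isIntegral _)))
    (associated_of_dvd_dvd (minpoly.dvd _ _ ?_) (h.mul_dvd (minpoly.dvd _ _ ?_)
      (minpoly.dvd _ _ ?_)))
  · rw [aeval_prod_apply]
    simp
  · have := minpoly.aeval k ((a, b) : A × B)
    rw [aeval_prod_apply] at this
    exact congrArg Prod.fst this
  · have := minpoly.aeval k ((a, b) : A × B)
    rw [aeval_prod_apply] at this
    exact congrArg Prod.snd this

lemma IsMonogenic.prod [IsAlgClosed k] {A : Type v} [Ring A] [Algebra k A] [Module.Finite k A]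
    {B : Type w} [Ring B] [Algebra k B] [Module.Finite k B] (hA : IsMonogenic k A)
    (hB : IsMonogenic k B) : IsMonogenic k (A × B) := by
  classical
  obtain ⟨a, ha⟩ := hA
  obtain ⟨b, hb⟩ := hB
  have hm := minpoly.monic (Algebra.IsIntegral.isIntegral (R := k) a)
  have hn := minpoly.monic (Algebra.IsIntegral.isIntegral (R := k) b)
  -- A shift by `c` makes the two root sets meet only if `c` is a difference of roots. There are
  -- finitely many such differences and `k` is infinite.
  obtain ⟨c, hc⟩ := Infinite.exists_notMem_finset
    (((minpoly k a).roots.toFinset ×ˢ (minpoly k b).roots.toFinset).image fun z => z.1 - z.2)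
  have hcop : IsCoprime (minpoly k a) (minpoly k (b + algebraMap k B c)) := by
    rw [minpoly_add_algebraMap, Polynomial.isCoprime_iff_aeval_ne_zero_of_isAlgClosed k k]
    intro r
    by_contra! H
    refine hc (Finset.mem_image.2 ⟨(r, r - c), ?_, by simp⟩)
    simpa [hm.ne_zero, hn.ne_zero] using H
  refine ⟨(a, b + algebraMap k B c), ?_⟩
  rw [minpoly_prod _ _ hcop, Module.finrank_prod, hm.natDegree_mul
    (minpoly.monic (Algebra.IsIntegral.isIntegral _)), minpoly_add_algebraMap, natDegree_comp,
    natDegree_X_sub_C, mul_one]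
  exact add_le_add ha hb

lemma TruncatedPolynomial.finite (n : ℕ) : Module.Finite k (TruncatedPolynomial k n) :=
  (monic_X_pow n).finite_adjoinRoot

lemma TruncatedPolynomial.finrank_eq (n : ℕ) : Module.finrank k (TruncatedPolynomial k n) = n := by
  rw [finrank_quotient_span_eq_natDegree, natDegree_X_pow]

lemma TruncatedPolynomial.minpoly_eq (n : ℕ) (c : k) :
    minpoly k ((Ideal.Quotient.mk _ X : TruncatedPolynomial k n) + algebraMap k _ c)
      = (X - C c) ^ n := by
  have := TruncatedPolynomial.finite (k := k) n
  have h : ∀ p : k[X], aeval (Ideal.Quotient.mk _ X : TruncatedPolynomial k n) p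
      = Ideal.Quotient.mk _ p := fun p => AdjoinRoot.aeval_eq p
  have h0 : minpoly k (Ideal.Quotient.mk _ X : TruncatedPolynomial k n) = X ^ n := by
    refine eq_of_monic_of_associated (minpoly.monic (Algebra.IsIntegral.isIntegral _))
      (monic_X_pow n) (associated_of_dvd_dvd (minpoly.dvd _ _ ?_) ?_)
    · rw [h, Ideal.Quotient.eq_zero_iff_mem]
      exact Ideal.subset_span rfl
    · have := minpoly.aeval k (Ideal.Quotient.mk _ X : TruncatedPolynomial k n)
      rw [h, Ideal.Quotient.eq_zero_iff_mem] at this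
      exact Ideal.mem_span_singleton.1 this
  rw [minpoly_add_algebraMap, h0]
  simp

/-- Each coordinate must be a root of the minimal polynomial. The linear factors are pairwise
coprime by injectivity, so their product divides it. -/
lemma minpoly_pi {ι : Type v} [Fintype ι] (f : ι → k) (hf : Function.Injective f) :
    minpoly k f = ∏ i, (X - C (f i)) := by
  refine eq_of_monic_of_associated (minpoly.monic (Algebra.IsIntegral.isIntegral _))
    (monic_prod_of_monic _ _ fun i _ => monic_X_sub_C _)
    (associated_of_dvd_dvd (minpoly.dvd _ _ ?_) (Finset.prod_dvd_of_coprime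
      (fun i _ j _ hij => isCoprime_X_sub_C_of_isUnit_sub (sub_ne_zero.2 (hf.ne hij)).isUnit)
      fun i _ => ?_))
  · funext i
    rw [aeval_pi]
    simp [Finset.prod_eq_zero (Finset.mem_univ i)]
  · have := congrFun (minpoly.aeval k f) i
    rw [aeval_pi] at this
    rw [dvd_iff_isRoot]
    simpa using this

end Monogenic

/-! ### Quotients of `k[X]` in dimension 4, sorted by root multiplicities -/

section MonogenicTable

variable {k : Type u} [Field k]

lemma minpoly_fin_two {a b : k} (h : a ≠ b) :
    minpoly k (![a, b] : Fin 2 → k) = (X - C a) * (X - C b) := by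
  rw [minpoly_pi]
  · simp
  · intro i j hij
    fin_cases i <;> fin_cases j <;> simp_all

lemma minpoly_fin_four {a b c d : k} (hab : a ≠ b) (hac : a ≠ c) (had : a ≠ d) (hbc : b ≠ c)
    (hbd : b ≠ d) (hcd : c ≠ d) :
    minpoly k (![a, b, c, d] : Fin 4 → k) = (X - C a) * (X - C b) * (X - C c) * (X - C d) := by
  rw [minpoly_pi]
  · simp [Fin.prod_univ_four]
  · intro i j hij
    fin_cases i <;> fin_cases j <;> simp_all

lemma isCoprime_X_sub_C {a b : k} (h : a ≠ b) : IsCoprime (X - C a) (X - C b) :=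
  isCoprime_X_sub_C_of_isUnit_sub (sub_ne_zero.2 h).isUnit

namespace FrobeniusTable

variable {A : Type v} [Ring A] [Algebra k A] [Module.Finite k A] {x : A}

lemma exists_of_minpoly_split (hA : Module.finrank k A = 4) {a b c d : k} (hab : a ≠ b)
    (hac : a ≠ c) (had : a ≠ d) (hbc : b ≠ c) (hbd : b ≠ d) (hcd : c ≠ d)
    (hx : minpoly k x = (X - C a) * (X - C b) * (X - C c) * (X - C d)) :
    ∃ t : FrobeniusTable k, Nonempty (A ≃ₐ[k] t.alg) := by
  have hm := minpoly_fin_four hab hac had hbc hbd hcd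
  have hd : ((X - C a) * (X - C b) * (X - C c) * (X - C d)).natDegree = 4 := by compute_degree!
  have e : Nonempty (A ≃ₐ[k] (Fin 4 → k)) := nonempty_equiv_of_minpoly_eq (by rw [hx, hA, hd])
    (by rw [hm, hd]; simp) (hx.trans hm.symm)
  exact ⟨split, e⟩

lemma exists_of_minpoly_splitDual (hA : Module.finrank k A = 4) {a b c : k} (hab : a ≠ b)
    (hac : a ≠ c) (hbc : b ≠ c) (hx : minpoly k x = (X - C a) * (X - C b) * (X - C c) ^ 2) :
    ∃ t : FrobeniusTable k, Nonempty (A ≃ₐ[k] t.alg) := by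
  have := TruncatedPolynomial.finite (k := k) 2
  have h1 := minpoly_fin_two hab
  have h2 := TruncatedPolynomial.minpoly_eq 2 c
  have hm := minpoly_prod (k := k)
    (![a, b] : Fin 2 → k)
    (Ideal.Quotient.mk _ X + algebraMap k _ c : TruncatedPolynomial k 2) (by
    rw [h1, h2]
    exact ((isCoprime_X_sub_C hac).mul_left (isCoprime_X_sub_C hbc)).pow_right)
  rw [h1, h2] at hm
  have hd : ((X - C a) * (X - C b) * (X - C c) ^ 2).natDegree = 4 := by compute_degree!
  have e : Nonempty (A ≃ₐ[k] ((Fin 2 → k) × TruncatedPolynomial k 2)) := nonempty_equiv_of_minpoly_eq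
    (by rw [hx, hA, hd]) (by rw [hm, hd, Module.finrank_prod, TruncatedPolynomial.finrank_eq]; simp)
    (hx.trans hm.symm)
  exact ⟨splitDual, e⟩

lemma exists_of_minpoly_splitCubic (hA : Module.finrank k A = 4) {a b : k} (hab : a ≠ b)
    (hx : minpoly k x = (X - C a) * (X - C b) ^ 3) :
    ∃ t : FrobeniusTable k, Nonempty (A ≃ₐ[k] t.alg) := by
  have := TruncatedPolynomial.finite (k := k) 3
  have h1 := minpoly.eq_X_sub_C' a
  have h2 := TruncatedPolynomial.minpoly_eq 3 b
  have hm := minpoly_prod (k := k) a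
    (Ideal.Quotient.mk _ X + algebraMap k _ b : TruncatedPolynomial k 3) (by
    rw [h1, h2]
    exact (isCoprime_X_sub_C hab).pow_right)
  rw [h1, h2] at hm
  have hd : ((X - C a) * (X - C b) ^ 3).natDegree = 4 := by compute_degree!
  have e : Nonempty (A ≃ₐ[k] (k × TruncatedPolynomial k 3)) := nonempty_equiv_of_minpoly_eq
    (by rw [hx, hA, hd]) (by rw [hm, hd, Module.finrank_prod, TruncatedPolynomial.finrank_eq]; simp)
    (hx.trans hm.symm)
  exact ⟨splitCubic, e⟩

lemma exists_of_minpoly_dualDual (hA : Module.finrank k A = 4) {a b : k} (hab : a ≠ b)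
    (hx : minpoly k x = (X - C a) ^ 2 * (X - C b) ^ 2) :
    ∃ t : FrobeniusTable k, Nonempty (A ≃ₐ[k] t.alg) := by
  have := TruncatedPolynomial.finite (k := k) 2
  have h1 := TruncatedPolynomial.minpoly_eq 2 a
  have h2 := TruncatedPolynomial.minpoly_eq 2 b
  have hm := minpoly_prod (k := k)
    (Ideal.Quotient.mk _ X + algebraMap k _ a : TruncatedPolynomial k 2)
    (Ideal.Quotient.mk _ X + algebraMap k _ b : TruncatedPolynomial k 2) (by
    rw [h1, h2]
    exact (isCoprime_X_sub_C hab).pow)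
  rw [h1, h2] at hm
  have hd : ((X - C a) ^ 2 * (X - C b) ^ 2).natDegree = 4 := by compute_degree!
  have e : Nonempty (A ≃ₐ[k] (TruncatedPolynomial k 2 × TruncatedPolynomial k 2)) := nonempty_equiv_of_minpoly_eq
    (by rw [hx, hA, hd]) (by rw [hm, hd, Module.finrank_prod, TruncatedPolynomial.finrank_eq])
    (hx.trans hm.symm)
  exact ⟨dualDual, e⟩

lemma exists_of_minpoly_quartic (hA : Module.finrank k A = 4) {a : k}
    (hx : minpoly k x = (X - C a) ^ 4) :
    ∃ t : FrobeniusTable k, Nonempty (A ≃ₐ[k] t.alg) := by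
  have := TruncatedPolynomial.finite (k := k) 4
  have hm := TruncatedPolynomial.minpoly_eq 4 a
  have hd : ((X - C a) ^ 4).natDegree = 4 := by compute_degree!
  have e : Nonempty (A ≃ₐ[k] TruncatedPolynomial k 4) := nonempty_equiv_of_minpoly_eq
    (by rw [hx, hA, hd]) (by rw [hm, hd, TruncatedPolynomial.finrank_eq])
    (hx.trans hm.symm)
  exact ⟨quartic, e⟩

/-- A monogenic algebra of dimension 4 is in the table. -/
lemma exists_of_isMonogenic [IsAlgClosed k] (hA : Module.finrank k A = 4)
    (h : IsMonogenic k A) : ∃ t : FrobeniusTable k, Nonempty (A ≃ₐ[k] t.alg) := by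
  obtain ⟨x, hx⟩ := h
  have hm := minpoly.monic (Algebra.IsIntegral.isIntegral (R := k) x)
  have hdeg : (minpoly k x).natDegree = 4 := by
    obtain ⟨e⟩ := nonempty_adjoinRoot_minpoly_equiv hx
    rw [← hA, ← e.toLinearEquiv.finrank_eq]
    exact finrank_quotient_span_eq_natDegree.symm
  have hs : (minpoly k x).Splits := IsAlgClosed.splits _
  obtain ⟨a, b, c, d, hr⟩ := Multiset.card_eq_four.1
    ((IsAlgClosed.card_roots_eq_natDegree (p := minpoly k x)).trans hdeg)
  have hp : minpoly k x = (X - C a) * (X - C b) * (X - C c) * (X - C d) := by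
    rw [hs.eq_prod_roots_of_monic hm, hr]
    simp [mul_assoc]
  -- Only the partition of the four roots into equal ones matters: 4, 3+1, 2+2, 2+1+1 and 1+1+1+1
  -- give the five entries with one generator.
  rcases eq_or_ne a b with rfl | hab
  · rcases eq_or_ne a c with rfl | hac
    · rcases eq_or_ne a d with rfl | had
      · exact exists_of_minpoly_quartic hA (a := a) (by rw [hp]; ring)
      · exact exists_of_minpoly_splitCubic hA had.symm (by rw [hp]; ring)
    · rcases eq_or_ne a d with rfl | had
      · exact exists_of_minpoly_splitCubic hA hac.symm (by rw [hp]; ring)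
      · rcases eq_or_ne c d with rfl | hcd
        · exact exists_of_minpoly_dualDual hA hac (by rw [hp]; ring)
        · exact exists_of_minpoly_splitDual hA hcd hac.symm had.symm (by rw [hp]; ring)
  · rcases eq_or_ne a c with rfl | hac
    · rcases eq_or_ne a d with rfl | had
      · exact exists_of_minpoly_splitCubic hA hab.symm (by rw [hp]; ring)
      · rcases eq_or_ne b d with rfl | hbd
        · exact exists_of_minpoly_dualDual hA hab (by rw [hp]; ring)
        · exact exists_of_minpoly_splitDual hA hbd hab.symm had.symm (by rw [hp]; ring)
    · rcases eq_or_ne a d with rfl | had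
      · rcases eq_or_ne b c with rfl | hbc
        · exact exists_of_minpoly_dualDual hA hab (by rw [hp]; ring)
        · exact exists_of_minpoly_splitDual hA hbc hab.symm hac.symm (by rw [hp]; ring)
      · rcases eq_or_ne b c with rfl | hbc
        · rcases eq_or_ne b d with rfl | hbd
          · exact exists_of_minpoly_splitCubic hA hab (by rw [hp]; ring)
          · exact exists_of_minpoly_splitDual hA had hab hbd.symm (by rw [hp]; ring)
        · rcases eq_or_ne b d with rfl | hbd
          · exact exists_of_minpoly_splitDual hA hac hab hbc.symm (by rw [hp]; ring)
          · rcases eq_or_ne c d with rfl | hcd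
            · exact exists_of_minpoly_splitDual hA hab hac hbc (by rw [hp]; ring)
            · exact exists_of_minpoly_split hA hab hac had hbc hbd hcd hp

end FrobeniusTable

end MonogenicTable

/-! ### The Peirce decomposition at an idempotent -/

section Peirce

variable {k : Type u} [Field k] {E : Type v} [Ring E] [Algebra k E]

/-- In a Frobenius algebra `eE(1 - e) = 0` implies `(1 - e)Ee = 0`. -/
lemma peirce_eq_zero_of_peirce_eq_zero [Module.Finite k E] {φ : E →ₗ[k] k}
    (hφ : ∀ a : E, a ≠ 0 → ∃ b, φ (a * b) ≠ 0) {e : E}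
    (he : e * e = e) (h : ∀ a, e * a * (1 - e) = 0) (a : E) : (1 - e) * a * e = 0 := by
  -- The hypothesis says that `eb = ebe` for all `b`, that is, `eE ⊆ Ee`. A dimension count gives
  -- equality, and then `1 - e` kills `Ee` from the left.
  have hle : LinearMap.range (LinearMap.mulLeft k e) ≤ LinearMap.range (LinearMap.mulRight k e) := by
    rintro _ ⟨b, rfl⟩
    refine ⟨e * b, ?_⟩
    have := h b
    rw [mul_sub, mul_one, sub_eq_zero] at this
    exact this.symm
  -- The pairing of `Ee` with `eE` through `φ` has no left kernel, since `φ(be · c) = φ(be · ec)`.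
  -- Hence `dim Ee ≤ dim eE`.
  have hinj : Function.Injective
      (((LinearMap.mul k E).compr₂ φ).domRestrict₁₂ (LinearMap.range (LinearMap.mulRight k e))
        (LinearMap.range (LinearMap.mulLeft k e))) := by
    rw [injective_iff_map_eq_zero]
    rintro ⟨_, b, rfl⟩ hb
    by_contra hne
    obtain ⟨c, hc⟩ := hφ (b * e) fun h => hne (Subtype.ext h)
    refine hc ?_
    have : φ (b * e * (e * c)) = 0 := LinearMap.congr_fun hb ⟨e * c, c, rfl⟩
    rwa [← mul_assoc, mul_assoc b e e, he] at this
  have hrank := LinearMap.finrank_le_finrank_of_injective hinj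
  rw [Module.finrank_linearMap, Module.finrank_self, mul_one] at hrank
  have heq := Submodule.eq_of_le_of_finrank_le hle hrank
  obtain ⟨b, hb⟩ : a * e ∈ LinearMap.range (LinearMap.mulLeft k e) := by
    rw [heq]
    exact ⟨a, rfl⟩
  rw [mul_assoc, ← hb, LinearMap.mulLeft_apply, ← mul_assoc, sub_mul, one_mul, he, sub_self,
    zero_mul]

/-- The elements `e, 1 - e, x, y` lie in the four different Peirce corners. Multiplying by `e` on
the left, on the right or on both sides isolates the terms. -/
lemma peirce_injective {e x y : E} (he : e * e = e) (h0 : e ≠ 0) (h1 : e ≠ 1)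
    (hx : x ≠ 0) (hy : y ≠ 0) (hex : e * x = x) (hxe : x * e = 0) (hey : e * y = 0)
    (hye : y * e = y) {a b c d : k} (h : a • e + b • (1 - e) + c • x + d • y = 0) :
    a = 0 ∧ b = 0 ∧ c = 0 ∧ d = 0 := by
  have hl := congrArg (e * ·) h
  have hlr := congrArg (e * · * e) h
  have hr := congrArg (· * e) h
  simp only [mul_add, mul_sub, mul_smul_comm, mul_one, he, hex, hey, sub_self, smul_zero, add_zero,
    mul_zero, add_mul, smul_mul_assoc, hxe, zero_mul, sub_mul, one_mul, hye] at hl hlr hr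
  have ha : a = 0 := (smul_eq_zero.1 hlr).resolve_right h0
  subst ha
  simp only [zero_smul, zero_add] at hl hr h
  have hc : c = 0 := (smul_eq_zero.1 hl).resolve_right hx
  have hd : d = 0 := (smul_eq_zero.1 hr).resolve_right hy
  subst hc hd
  simp only [zero_smul, add_zero] at h
  exact ⟨rfl, (smul_eq_zero.1 h).resolve_right (sub_ne_zero.2 h1.symm), rfl, rfl⟩

/-- The linear map with values `e, 1 - e, x, y` on the standard basis. -/
def peirceMap (k : Type u) [Field k] {E : Type v} [Ring E] [Algebra k E] (e x y : E) :
    (k × k × k × k) →ₗ[k] E where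
  toFun u := u.1 • e + u.2.1 • (1 - e) + u.2.2.1 • x + u.2.2.2 • y
  map_add' u v := by
    simp only [Prod.fst_add, Prod.snd_add]
    module
  map_smul' t u := by
    simp only [Prod.smul_fst, Prod.smul_snd, smul_eq_mul, RingHom.id_apply]
    module

/-- The four independent elements form a basis, so every corner is a line. This makes `xy` a
multiple of `e` and `yx` a multiple of `1 - e`. -/
lemma exists_peirceAlg_equiv [Module.Finite k E] {e x y : E} (he : e * e = e) (h0 : e ≠ 0) (h1 : e ≠ 1)
    (hx : x ≠ 0) (hy : y ≠ 0) (hex : e * x = x) (hxe : x * e = 0) (hey : e * y = 0)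
    (hye : y * e = y) (hE : Module.finrank k E ≤ 4) :
    ∃ α : k, Nonempty (PeirceAlg α ≃ₐ[k] E) := by
  have hinj : Function.Injective (peirceMap k e x y) := by
    rw [injective_iff_map_eq_zero]
    rintro ⟨a, b, c, d⟩ h
    obtain ⟨rfl, rfl, rfl, rfl⟩ := peirce_injective he h0 h1 hx hy hex hxe hey hye h
    rfl
  have hle := LinearMap.finrank_le_finrank_of_injective hinj
  have h4 : Module.finrank k (k × k × k × k) = 4 := by simp
  have hE4 : Module.finrank k E = 4 := by omega
  have hsurj := (LinearMap.injective_iff_surjective_of_finrank_eq_finrank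
    (h4.trans hE4.symm)).1 hinj
  obtain ⟨⟨a, b, c, d⟩, hxy⟩ := hsurj (x * y)
  obtain ⟨⟨a', b', c', d'⟩, hyx⟩ := hsurj (y * x)
  change a • e + b • (1 - e) + c • x + d • y = x * y at hxy
  change a' • e + b' • (1 - e) + c' • x + d' • y = y * x at hyx
  have hxy' : x * y = a • e := by
    have := congrArg (e * · * e) hxy
    simp only [mul_add, mul_sub, mul_smul_comm, mul_one, he, hex, hey, sub_self, smul_zero,
      add_zero, add_mul, smul_mul_assoc, hxe] at this
    rw [this, mul_assoc, mul_assoc, hye, ← mul_assoc, hex]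
  have hyx' : y * x = b' • (1 - e) := by
    have := congrArg ((1 - e) * · * (1 - e)) hyx
    simp only [mul_add, mul_sub, sub_mul, add_mul, mul_smul_comm, smul_mul_assoc, mul_one, one_mul,
      he, hex, hey, hxe, hye, sub_self, smul_zero, add_zero, sub_zero, zero_add,
      mul_assoc] at this
    rw [mul_zero, ← mul_assoc e, hey, zero_mul, mul_zero, sub_zero, sub_zero, sub_zero,
      add_sub_cancel_right] at this
    exact this.symm
  -- Associativity `(xy)x = x(yx)` identifies the two scalars.
  have hab : a = b' := by
    have h2 : a • x = b' • x := by
      have := mul_assoc x y x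
      rw [hxy', hyx'] at this
      simpa [hex, mul_sub, hxe] using this
    rw [← sub_eq_zero, ← sub_smul] at h2
    exact sub_eq_zero.1 ((smul_eq_zero.1 h2).resolve_right hx)
  subst hab
  let F : PeirceAlg a →ₐ[k] E := PeirceAlg.lift e (1 - e) x y (by abel)
    (by rw [mul_sub, he, mul_one, sub_self]) (by rw [sub_mul, he, one_mul, sub_self]) hex
    (by rw [mul_sub, hxe, mul_one, sub_zero]) (by rw [sub_mul, hey, one_mul, sub_zero]) hye hxy' hyx'
  exact ⟨a, ⟨AlgEquiv.ofBijective F (PeirceAlg.lift_bijective hE4 F hinj)⟩⟩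

end Peirce

/-! ### Splitting off factors by central idempotents -/

section CentralCorner

variable (k : Type u) [Field k] {E : Type v} [Ring E] [Algebra k E]

/-- The ideal `eE` for a central idempotent `e`. -/
def CentralCorner (e : E) (_he : e * e = e) (_hc : ∀ a, e * a = a * e) :
    NonUnitalSubalgebra k E where
  carrier := {x | e * x = x}
  add_mem' := fun {a b} (ha : e * a = a) (hb : e * b = b) =>
    show e * (a + b) = a + b by rw [mul_add, ha, hb]
  zero_mem' := mul_zero e
  mul_mem' := fun {a b} (ha : e * a = a) _ => show e * (a * b) = a * b by rw [← mul_assoc, ha]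
  smul_mem' := fun c a (ha : e * a = a) => show e * (c • a) = c • a by rw [mul_smul_comm, ha]

variable {k} {e : E} {he : e * e = e} {hc : ∀ a, e * a = a * e}

instance : Ring (CentralCorner k e he hc) :=
  { (inferInstance : NonUnitalRing (CentralCorner k e he hc)) with
    one := ⟨e, he⟩
    one_mul := fun a => Subtype.ext a.2
    mul_one := fun a => Subtype.ext ((hc _).symm.trans a.2) }

instance : Algebra k (CentralCorner k e he hc) :=
  Algebra.ofModule smul_mul_assoc mul_smul_comm

lemma CentralCorner.isFrobeniusAlgebra (h : IsFrobeniusAlgebra k E) :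
    IsFrobeniusAlgebra k (CentralCorner k e he hc) := by
  have := h.finite
  have : Module.Finite k (CentralCorner k e he hc) :=
    inferInstanceAs (Module.Finite k (CentralCorner k e he hc).toSubmodule)
  obtain ⟨φ, hφ⟩ := h.exists_functional
  refine .of_functional (φ ∘ₗ (CentralCorner k e he hc).toSubmodule.subtype) fun a ha => ?_
  -- The witnesses found in `E` may be multiplied by `e`, because `ae = ea = a` in the corner.
  obtain ⟨⟨b, hb⟩, c, hc'⟩ := hφ a fun h => ha (Subtype.ext h)
  have he' : ∀ b, e * (e * b) = e * b := fun b => by rw [← mul_assoc, he]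
  have ha' : e * (a : E) = a := a.2
  refine ⟨⟨e * b, he' b⟩, ⟨e * c, he' c⟩, ?_, ?_⟩
  · change φ (a * (e * b)) ≠ 0
    rwa [← mul_assoc, ← hc, ha']
  · change φ (e * c * a) ≠ 0
    rwa [hc, mul_assoc, ha']

lemma CentralCorner.nonempty_equiv_prod (he : e * e = e) (hc : ∀ a, e * a = a * e)
    (hf : (1 - e) * (1 - e) = 1 - e) (hd : ∀ a, (1 - e) * a = a * (1 - e)) :
    Nonempty (E ≃ₐ[k] CentralCorner k e he hc × CentralCorner k (1 - e) hf hd) := by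
  let L : E →ₗ[k] CentralCorner k e he hc × CentralCorner k (1 - e) hf hd :=
    { toFun := fun a => (⟨e * a, by change e * (e * a) = e * a; rw [← mul_assoc, he]⟩,
        ⟨(1 - e) * a, by change (1 - e) * ((1 - e) * a) = (1 - e) * a; rw [← mul_assoc, hf]⟩)
      map_add' := fun a b => Prod.ext (Subtype.ext (mul_add _ _ _)) (Subtype.ext (mul_add _ _ _))
      map_smul' := fun t a => Prod.ext (Subtype.ext (mul_smul_comm _ _ _))
        (Subtype.ext (mul_smul_comm _ _ _)) }
  have hmul : ∀ g : E, g * g = g → (∀ a, g * a = a * g) → ∀ a b, g * (a * b) = g * a * (g * b) := by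
    intro g hg hgc a b
    rw [← mul_assoc (g * a), hgc a, mul_assoc a g g, hg, ← hgc, mul_assoc]
  let F : E →ₐ[k] CentralCorner k e he hc × CentralCorner k (1 - e) hf hd :=
    AlgHom.ofLinearMap L (Prod.ext (Subtype.ext (mul_one _)) (Subtype.ext (mul_one _)))
      fun a b => Prod.ext (Subtype.ext (hmul e he hc a b)) (Subtype.ext (hmul _ hf hd a b))
  refine ⟨AlgEquiv.ofBijective F ⟨?_, ?_⟩⟩
  · rw [injective_iff_map_eq_zero]
    intro a ha
    have h1 : e * a = 0 := congrArg (fun z => (z.1 : E)) ha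
    have h2 : (1 - e) * a = 0 := congrArg (fun z => (z.2 : E)) ha
    rwa [sub_mul, h1, sub_zero, one_mul] at h2
  · rintro ⟨⟨a, ha⟩, ⟨b, hb⟩⟩
    have ha : e * a = a := ha
    have hb : (1 - e) * b = b := hb
    have hb' : e * b = 0 := by
      rw [sub_mul, one_mul] at hb
      simpa using hb
    refine ⟨a + b, Prod.ext (Subtype.ext ?_) (Subtype.ext ?_)⟩
    · change e * (a + b) = a
      rw [mul_add, ha, hb', add_zero]
    · change (1 - e) * (a + b) = b
      rw [mul_add, sub_mul, ha, hb, one_mul, sub_self, zero_add]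

/-- A central idempotent decomposes a Frobenius algebra into a product of Frobenius algebras. -/
lemma exists_prod_equiv_of_central (h : IsFrobeniusAlgebra k E) (he : e * e = e)
    (hc : ∀ a, e * a = a * e) (h0 : e ≠ 0) (h1 : e ≠ 1) :
    ∃ (A B : Type v) (_ : Ring A) (_ : Algebra k A) (_ : Ring B) (_ : Algebra k B),
      IsFrobeniusAlgebra k A ∧ IsFrobeniusAlgebra k B ∧ Nontrivial A ∧ Nontrivial B ∧
        Nonempty (E ≃ₐ[k] A × B) := by
  have hf : (1 - e) * (1 - e) = 1 - e := by
    rw [mul_sub, mul_one, sub_mul, he, one_mul, sub_self, sub_zero]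
  have hd : ∀ a, (1 - e) * a = a * (1 - e) := fun a => by
    rw [mul_sub, sub_mul, hc, mul_one, one_mul]
  refine ⟨CentralCorner k e he hc, CentralCorner k (1 - e) hf hd, inferInstance, inferInstance,
    inferInstance, inferInstance, CentralCorner.isFrobeniusAlgebra h,
    CentralCorner.isFrobeniusAlgebra h, ⟨1, 0, fun h => h0 ?_⟩, ⟨1, 0, fun h => h1 ?_⟩,
    CentralCorner.nonempty_equiv_prod he hc hf hd⟩
  · exact congrArg Subtype.val h
  · exact (sub_eq_zero.1 (congrArg Subtype.val h)).symm

end CentralCorner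

/-! ### Algebras in which every element is a unit or nilpotent -/

section LocalAlgebras

variable {k : Type u} [Field k] {E : Type v} [Ring E] [Algebra k E]

/-- In a finite-dimensional algebra without nontrivial idempotents every element is a unit or
nilpotent. -/
lemma isUnit_or_isNilpotent_of_idempotents [Module.Finite k E]
    (hid : ∀ e : E, e * e = e → e = 0 ∨ e = 1) (a : E) : IsUnit a ∨ IsNilpotent a := by
  have hm := minpoly.ne_zero (Algebra.IsIntegral.isIntegral (R := k) a)
  obtain ⟨q, hq, hnd⟩ := (minpoly k a).exists_eq_pow_rootMultiplicity_mul_and_not_dvd hm 0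
  generalize (minpoly k a).rootMultiplicity 0 = n at hq
  rw [C_0, sub_zero] at hq hnd
  -- With Bézout coefficients `s` and `t`, `s X^(n+1)` evaluates at `a` to the Fitting idempotent.
  -- The exponent `n + 1` instead of `n` leaves a factor `X` even for `n = 0`, so that the
  -- idempotent being 1 makes `a` invertible.
  have hcop : IsCoprime (X ^ (n + 1)) q :=
    ((irreducible_X (R := k)).coprime_iff_not_dvd.2 hnd).pow_left
  obtain ⟨s, t, hst⟩ := hcop
  have hzero : ∀ r : k[X], aeval a (r * (X ^ (n + 1) * q)) = 0 := by
    intro r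
    rw [← minpoly.dvd_iff, hq]
    exact ⟨r * X, by ring⟩
  have hsq : s * X ^ (n + 1) * (s * X ^ (n + 1)) =
      s * X ^ (n + 1) - s * t * (X ^ (n + 1) * q) := by
    linear_combination (s * X ^ (n + 1)) * hst
  have hid' := hid (aeval a (s * X ^ (n + 1))) (by
    rw [← map_mul, hsq, map_sub, hzero, sub_zero])
  rcases hid' with h | h
  · right
    refine ⟨n + 1, ?_⟩
    have hX : X ^ (n + 1) = X ^ (n + 1) * (s * X ^ (n + 1)) + t * (X ^ (n + 1) * q) := by
      linear_combination (-X ^ (n + 1)) * hst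
    have h2 := congrArg (aeval a) hX
    rw [map_add, map_mul, h, hzero, mul_zero, add_zero, map_pow, aeval_X] at h2
    exact h2
  · left
    have h1 : X * (s * X ^ n) = s * X ^ (n + 1) := by ring
    have h2 : s * X ^ n * X = s * X ^ (n + 1) := by ring
    refine isUnit_iff_exists.2 ⟨aeval a (s * X ^ n), ?_, ?_⟩
    · have := congrArg (aeval a) h1
      rwa [map_mul, aeval_X, h] at this
    · have := congrArg (aeval a) h2
      rwa [map_mul, aeval_X, h] at this

/-- A one-sided inverse suffices because `ba = 1` implies `bⁿaⁿ = 1`. -/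
lemma not_isNilpotent_of_mul_eq_one {R : Type v} [Ring R] [Nontrivial R] {a b : R}
    (h : b * a = 1) : ¬ IsNilpotent a ∧ ¬ IsNilpotent b := by
  constructor
  · rintro ⟨n, hn⟩
    have := pow_mul_pow_eq_one n h
    simp [hn] at this
  · rintro ⟨n, hn⟩
    have := pow_mul_pow_eq_one n h
    simp [hn] at this

lemma isNilpotent_mul_of_left {R : Type v} [Ring R] [Nontrivial R]
    (hR : ∀ a : R, IsUnit a ∨ IsNilpotent a) {a : R} (ha : IsNilpotent a) (b : R) :
    IsNilpotent (a * b) := by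
  refine (hR _).resolve_left fun ⟨w, hw⟩ => ?_
  refine (not_isNilpotent_of_mul_eq_one (b := a) (a := b * ↑w⁻¹) ?_).2 ha
  rw [← mul_assoc, ← hw, Units.mul_inv]

lemma isNilpotent_mul_of_right {R : Type v} [Ring R] [Nontrivial R]
    (hR : ∀ a : R, IsUnit a ∨ IsNilpotent a) {a : R} (ha : IsNilpotent a) (b : R) :
    IsNilpotent (b * a) := by
  refine (hR _).resolve_left fun ⟨w, hw⟩ => ?_
  refine (not_isNilpotent_of_mul_eq_one (b := ↑w⁻¹ * b) (a := a) ?_).1 ha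
  rw [mul_assoc, ← hw, Units.inv_mul]

/-- If `a + b` were a unit `w`, then `w⁻¹b = 1 - w⁻¹a` would be both a unit and nilpotent. -/
lemma isNilpotent_add_of_local {R : Type v} [Ring R] [Nontrivial R]
    (hR : ∀ a : R, IsUnit a ∨ IsNilpotent a) {a b : R} (ha : IsNilpotent a) (hb : IsNilpotent b) :
    IsNilpotent (a + b) := by
  refine (hR _).resolve_left fun ⟨w, hw⟩ => ?_
  have h1 := isNilpotent_mul_of_right hR ha ↑w⁻¹
  have h2 := isNilpotent_mul_of_right hR hb ↑w⁻¹
  have h3 : (↑w⁻¹ * b : R) = 1 - ↑w⁻¹ * a := by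
    rw [eq_sub_iff_add_eq', ← mul_add, ← hw, Units.inv_mul]
  obtain ⟨z, hz⟩ := h1.isUnit_one_sub
  rw [← h3] at hz
  refine (not_isNilpotent_of_mul_eq_one (b := ↑z⁻¹) (a := ↑w⁻¹ * b) ?_).1 h2
  rw [← hz, Units.inv_mul]

variable (k) in
/-- The maximal ideal of a local algebra with nilpotent maximal ideal. -/
def nilpotents [Nontrivial E] (hR : ∀ a : E, IsUnit a ∨ IsNilpotent a) : Submodule k E where
  carrier := {a | IsNilpotent a}
  add_mem' := isNilpotent_add_of_local hR
  zero_mem' := IsNilpotent.zero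
  smul_mem' c a (ha : IsNilpotent a) := show IsNilpotent (c • a) by
    rw [← smul_one_mul]
    exact isNilpotent_mul_of_right hR ha _

section Nilpotents

variable [Nontrivial E] {hR : ∀ a : E, IsUnit a ∨ IsNilpotent a}

lemma mem_nilpotents {a : E} : a ∈ nilpotents k hR ↔ IsNilpotent a := Iff.rfl

lemma nilpotents_mul_self_le : nilpotents k hR * nilpotents k hR ≤ nilpotents k hR :=
  Submodule.mul_le.2 fun _ ha b _ => isNilpotent_mul_of_left hR ha b

lemma one_notMem_nilpotents : (1 : E) ∉ nilpotents k hR := fun h =>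
  (not_isNilpotent_of_mul_eq_one (one_mul (1 : E))).1 h

/-- Subtracting an eigenvalue produces a non-unit. This is where the residue field is seen to be
`k`. -/
lemma exists_sub_mem_nilpotents [IsAlgClosed k] [Module.Finite k E] (a : E) :
    ∃ c : k, a - algebraMap k E c ∈ nilpotents k hR := by
  obtain ⟨c, hc⟩ := spectrum.nonempty_of_isAlgClosed_of_finiteDimensional k a
  refine ⟨c, ?_⟩
  have := (hR _).resolve_left (spectrum.mem_iff.1 hc)
  rw [← neg_sub]
  exact this.neg

lemma finrank_nilpotents [IsAlgClosed k] [Module.Finite k E] :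
    Module.finrank k (nilpotents k hR) + 1 = Module.finrank k E := by
  have h := Submodule.finrank_sup_add_finrank_inf_eq (nilpotents k hR) (k ∙ (1 : E))
  have h1 : nilpotents k hR ⊔ (k ∙ (1 : E)) = ⊤ := by
    rw [eq_top_iff]
    intro a _
    obtain ⟨c, hc⟩ := exists_sub_mem_nilpotents (k := k) (hR := hR) a
    rw [Algebra.algebraMap_eq_smul_one] at hc
    rw [← sub_add_cancel a (c • (1 : E))]
    exact Submodule.add_mem_sup hc (Submodule.smul_mem _ _ (Submodule.mem_span_singleton_self _))
  have h2 : nilpotents k hR ⊓ (k ∙ (1 : E)) = ⊥ := by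
    rw [eq_bot_iff]
    rintro a ⟨ha, ha'⟩
    obtain ⟨c, rfl⟩ := Submodule.mem_span_singleton.1 ha'
    by_cases hc : c = 0
    · simp [hc]
    · refine absurd ?_ (one_notMem_nilpotents (k := k) (hR := hR))
      have := (nilpotents k hR).smul_mem c⁻¹ ha
      rwa [smul_smul, inv_mul_cancel₀ hc, one_smul] at this
  rw [h1, h2, finrank_top, finrank_bot, finrank_span_singleton one_ne_zero] at h
  omega

/-- The nilpotents lie in the Jacobson radical, which is nilpotent in an Artinian ring. Powers of
subspaces are compared with powers of ideals by induction. -/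
lemma exists_nilpotents_pow_eq_bot [Module.Finite k E] : ∃ n : ℕ, nilpotents k hR ^ n = ⊥ := by
  have : IsArtinianRing E := isArtinian_of_tower k inferInstance
  obtain ⟨n, hn⟩ := IsSemiprimaryRing.isNilpotent (R := E)
  have hmem : ∀ a ∈ nilpotents k hR, a ∈ Ring.jacobson E := by
    intro a ha
    rw [← Ideal.jacobson_bot, Ideal.mem_jacobson_iff]
    intro y
    obtain ⟨w, hw⟩ := (isNilpotent_mul_of_right hR ha y).isUnit_one_add
    refine ⟨↑w⁻¹, ?_⟩
    rw [mul_assoc, Ideal.mem_bot, sub_eq_zero]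
    calc (↑w⁻¹ * (y * a) + ↑w⁻¹ : E) = ↑w⁻¹ * (1 + y * a) := by rw [mul_add, mul_one, add_comm]
      _ = 1 := by rw [← hw, Units.inv_mul]
  have hpow : ∀ m : ℕ, ∀ a ∈ nilpotents k hR ^ m, a ∈ Ring.jacobson E ^ m := by
    intro m
    induction m with
    | zero =>
      intro a _
      rw [Submodule.pow_zero, Ideal.one_eq_top]
      trivial
    | succ m ih =>
      intro a ha
      rw [pow_succ'] at ha
      rw [Ideal.IsTwoSided.pow_succ]
      refine Submodule.mul_induction_on ha (fun x hx y hy => ?_) fun x y hx hy => add_mem hx hy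
      exact Ideal.mul_mem_mul (hmem x hx) (ih y hy)
  refine ⟨n, ?_⟩
  rw [eq_bot_iff]
  intro a ha
  have := hpow n a ha
  rw [hn] at this
  exact this

/-- If the maximal ideal is generated modulo its square by `x`, then so is the algebra. -/
lemma adjoin_eq_top_of_nilpotents_le [IsAlgClosed k] [Module.Finite k E] {x : E}
    (hx : x ∈ nilpotents k hR)
    (h : nilpotents k hR ≤ (k ∙ x) ⊔ nilpotents k hR * nilpotents k hR) :
    Algebra.adjoin k {x} = ⊤ := by
  set J := nilpotents k hR
  set A := Subalgebra.toSubmodule (Algebra.adjoin k {x}) with hA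
  have hJJ : J * J ≤ J := nilpotents_mul_self_le
  have hAA : A * A ≤ A := Submodule.mul_le.2 fun a ha b hb => (Algebra.adjoin k {x}).mul_mem ha hb
  have hpow : ∀ m : ℕ, J ^ (m + 1) ≤ J := by
    intro m
    induction m with
    | zero => rw [zero_add, pow_one]
    | succ m ih =>
      rw [pow_succ]
      exact (mul_le_mul' ih le_rfl).trans hJJ
  -- Substituting the approximation into both factors of `J²` improves it by one power: products of
  -- two elements of `A` stay in `A`, and all other terms gain a factor from `J`.
  have key : ∀ m : ℕ, J ≤ (A ⊓ J) ⊔ J ^ (m + 1) := by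
    intro m
    induction m with
    | zero =>
      rw [zero_add, pow_one]
      exact le_sup_right
    | succ m ih =>
      refine h.trans (sup_le ?_ ?_)
      · refine le_trans ?_ le_sup_left
        rw [Submodule.span_singleton_le_iff_mem]
        exact ⟨Algebra.subset_adjoin rfl, hx⟩
      · refine (mul_le_mul' ih ih).trans ?_
        rw [Submodule.mul_sup, Submodule.sup_mul, Submodule.sup_mul]
        refine sup_le (sup_le ?_ ?_) (sup_le ?_ ?_)
        · exact le_sup_of_le_left (le_inf ((mul_le_mul' inf_le_left inf_le_left).trans hAA)
            ((mul_le_mul' inf_le_right inf_le_right).trans hJJ))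
        · refine le_sup_of_le_right ?_
          rw [pow_succ _ (m + 1)]
          exact mul_le_mul' le_rfl inf_le_right
        · refine le_sup_of_le_right ?_
          rw [pow_succ' _ (m + 1)]
          exact mul_le_mul' inf_le_right le_rfl
        · refine le_sup_of_le_right ?_
          rw [pow_succ _ (m + 1)]
          exact mul_le_mul' le_rfl (hpow m)
  obtain ⟨n, hn⟩ := exists_nilpotents_pow_eq_bot (k := k) (hR := hR)
  have hJA : J ≤ A := by
    have := key n
    rw [pow_succ, hn, Submodule.bot_mul, sup_bot_eq] at this
    exact this.trans inf_le_left
  rw [eq_top_iff]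
  intro a _
  obtain ⟨c, hc⟩ := exists_sub_mem_nilpotents (k := k) (hR := hR) a
  rw [← sub_add_cancel a (algebraMap k E c)]
  exact add_mem (hJA hc) (Subalgebra.algebraMap_mem _ c)

end Nilpotents

lemma isMonogenic_of_adjoin_eq_top [Module.Finite k E] {x : E} (h : Algebra.adjoin k {x} = ⊤) :
    IsMonogenic k E := by
  refine ⟨x, ?_⟩
  have hm := minpoly.monic (Algebra.IsIntegral.isIntegral (R := k) x)
  have : Module.Finite k (AdjoinRoot (minpoly k x)) := hm.finite_adjoinRoot
  let F : AdjoinRoot (minpoly k x) →ₐ[k] E :=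
    Ideal.Quotient.liftₐ _ (aeval x) fun q hq => by
      rw [← minpoly.dvd_iff]
      exact Ideal.mem_span_singleton.1 hq
  have hF : Function.Surjective F := by
    intro a
    have ha : a ∈ Algebra.adjoin k {x} := h ▸ Algebra.mem_top
    rw [Algebra.adjoin_singleton_eq_range_aeval] at ha
    obtain ⟨q, rfl⟩ := ha
    exact ⟨AdjoinRoot.mk _ q, rfl⟩
  have hrank : Module.finrank k (AdjoinRoot (minpoly k x)) = (minpoly k x).natDegree :=
    finrank_quotient_span_eq_natDegree
  rw [← hrank]
  exact LinearMap.finrank_le_finrank_of_surjective (f := F.toLinearMap) hF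

section Nilpotents

variable [Nontrivial E] {hR : ∀ a : E, IsUnit a ∨ IsNilpotent a} [IsAlgClosed k]
  [Module.Finite k E]

/-- The hypothesis says that `J/J²` has dimension at most 1, so any element of `J` outside `J²`
generates `J` modulo `J²`. -/
lemma isMonogenic_of_finrank_nilpotents_le
    (h : Module.finrank k (nilpotents k hR) ≤
      Module.finrank k (nilpotents k hR * nilpotents k hR : Submodule k E) + 1) :
    IsMonogenic k E := by
  set J := nilpotents k hR with hJ
  suffices H : ∃ x ∈ J, J ≤ (k ∙ x) ⊔ J * J by
    obtain ⟨x, hx, hle⟩ := H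
    exact isMonogenic_of_adjoin_eq_top (adjoin_eq_top_of_nilpotents_le hx hle)
  by_cases hle : J ≤ J * J
  · exact ⟨0, J.zero_mem, hle.trans le_sup_right⟩
  · obtain ⟨x, hx, hx'⟩ := SetLike.not_le_iff_exists.1 hle
    refine ⟨x, hx, ?_⟩
    have hlt : J * J < (k ∙ x) ⊔ J * J := by
      refine lt_of_le_of_ne le_sup_right fun heq => hx' ?_
      rw [heq]
      exact Submodule.mem_sup_left (Submodule.mem_span_singleton_self x)
    have h2 := Submodule.finrank_lt_finrank_of_lt hlt
    have h3 : (k ∙ x) ⊔ J * J ≤ J :=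
      sup_le ((Submodule.span_singleton_le_iff_mem _ _).2 hx) nilpotents_mul_self_le
    exact (Submodule.eq_of_le_of_finrank_le h3 (by omega)).ge

/-- Since `aJ = 0`, the right ideal `aE` is just the line `ka`, on which `φ` would vanish. In other
words, `φ` is injective on the annihilator of `J`. -/
lemma eq_zero_of_mul_nilpotents_eq_zero {φ : E →ₗ[k] k}
    (hφ : ∀ a : E, a ≠ 0 → ∃ b, φ (a * b) ≠ 0) {a : E} (ha : ∀ j ∈ nilpotents k hR, a * j = 0)
    (h0 : φ a = 0) : a = 0 := by
  by_contra hne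
  obtain ⟨b, hb⟩ := hφ a hne
  obtain ⟨c, hc⟩ := exists_sub_mem_nilpotents (k := k) (hR := hR) b
  refine hb ?_
  rw [← sub_add_cancel b (algebraMap k E c), mul_add, ha _ hc, zero_add,
    Algebra.algebraMap_eq_smul_one, mul_smul_comm, mul_one, map_smul, h0, smul_zero]

lemma finrank_nilpotents_le_one {φ : E →ₗ[k] k} (hφ : ∀ a : E, a ≠ 0 → ∃ b, φ (a * b) ≠ 0)
    (h : nilpotents k hR * nilpotents k hR = ⊥) : Module.finrank k (nilpotents k hR) ≤ 1 := by
  have hinj : Function.Injective (φ ∘ₗ (nilpotents k hR).subtype) := by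
    rw [injective_iff_map_eq_zero]
    rintro ⟨a, ha⟩ h0
    refine Subtype.ext (eq_zero_of_mul_nilpotents_eq_zero (hR := hR) hφ (fun j hj => ?_) h0)
    have := Submodule.mul_mem_mul ha hj
    rwa [h] at this
  have := LinearMap.finrank_le_finrank_of_injective hinj
  rwa [Module.finrank_self] at this

/-- A local Frobenius algebra of dimension at most 3 is monogenic. -/
lemma isMonogenic_of_local_of_finrank_le_three (hR : ∀ a : E, IsUnit a ∨ IsNilpotent a)
    {φ : E →ₗ[k] k} (hφ : ∀ a : E, a ≠ 0 → ∃ b, φ (a * b) ≠ 0) (hE : Module.finrank k E ≤ 3) :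
    IsMonogenic k E := by
  refine isMonogenic_of_finrank_nilpotents_le (hR := hR) ?_
  have h1 := finrank_nilpotents (k := k) (hR := hR)
  by_cases h : nilpotents k hR * nilpotents k hR = ⊥
  · exact (finrank_nilpotents_le_one hφ h).trans (Nat.le_add_left _ _)
  · have := Submodule.one_le_finrank_iff.2 h
    omega

end Nilpotents

end LocalAlgebras

/-! ### Exhaustiveness of the table -/

section Classification

variable {k : Type u} [Field k]

/-- A degenerate form has a vector `bx + cy` in its left radical. Together with `z` it spans a plane
in which every line is a right ideal, and `φ` must vanish on one of these lines. -/
lemma FormAlg.det_ne_zero_of_isFrobeniusAlgebra {p q r s : k}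
    (h : IsFrobeniusAlgebra k (FormAlg p q r s)) : p * s - q * r ≠ 0 := by
  intro hdet
  obtain ⟨φ, hφ⟩ := h.exists_functional
  obtain ⟨b, c, hbc, h1, h2⟩ : ∃ b c : k, (b ≠ 0 ∨ c ≠ 0) ∧ b * p + c * r = 0 ∧
      b * q + c * s = 0 := by
    by_cases hpr : p = 0 ∧ r = 0
    · obtain ⟨rfl, rfl⟩ := hpr
      by_cases hqs : q = 0 ∧ s = 0
      · obtain ⟨rfl, rfl⟩ := hqs
        exact ⟨1, 0, by simp, by simp, by simp⟩
      · refine ⟨s, -q, ?_, by ring, by ring⟩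
        rw [neg_ne_zero]
        tauto
    · refine ⟨r, -p, ?_, by ring, by linear_combination -hdet⟩
      rw [neg_ne_zero]
      tauto
  have hzero : ∀ d e : k, φ (mk 0 (b * d) (c * d) e) = 0 → (mk 0 (b * d) (c * d) e :
      FormAlg p q r s) = 0 := by
    intro d e h0
    by_contra hne
    obtain ⟨⟨v, hv⟩, -⟩ := hφ _ hne
    refine hv ?_
    obtain ⟨a', b', c', d', rfl⟩ := mk_surj v
    have : (mk 0 (b * d) (c * d) e * mk a' b' c' d' : FormAlg p q r s) =
        a' • mk 0 (b * d) (c * d) e := by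
      simp only [mk_mul, smul_mk, mk_inj]
      refine ⟨by ring, by ring, by ring, ?_⟩
      linear_combination d * b' * h1 + d * c' * h2
    rw [this, map_smul, h0, smul_zero]
  set θ := φ (mk 0 0 0 1) with hθ
  have hlin : ∀ d e : k, φ (mk 0 (b * d) (c * d) e) = d * φ (mk 0 b c 0) + e * θ := by
    intro d e
    have hsum : (mk 0 (b * d) (c * d) e : FormAlg p q r s) = d • mk 0 b c 0 + e • mk 0 0 0 1 := by
      simp only [smul_mk, mk_add, mk_inj]
      refine ⟨by ring, by ring, by ring, by ring⟩
    rw [hsum, map_add, map_smul, map_smul, smul_eq_mul, smul_eq_mul]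
  -- The combination of `bx + cy` and `z` chosen here lies in the kernel of `φ`. Its vanishing gives
  -- `θ = φ(z) = 0`, after which `z` itself lies in the kernel.
  have h3 := hzero θ (-φ (mk 0 b c 0)) (by rw [hlin]; ring)
  rw [zero_def, mk_inj] at h3
  have hθ0 : θ = 0 := by
    rcases hbc with hb | hc
    · exact (mul_eq_zero.1 h3.2.1).resolve_left hb
    · exact (mul_eq_zero.1 h3.2.2.1).resolve_left hc
  have h4 := hzero 0 1 (by rw [hlin, hθ0]; ring)
  rw [zero_def, mk_inj] at h4
  exact one_ne_zero h4.2.2.2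

/-- A Frobenius algebra with an idempotent that is not central has dimension at least 4, and those
of dimension 4 are given by a scalar. -/
lemma exists_peirceAlg_equiv_of_not_central {E : Type v} [Ring E] [Algebra k E]
    (h : IsFrobeniusAlgebra k E) (hE : Module.finrank k E ≤ 4) {e : E} (he : e * e = e)
    (hc : ¬ ∀ a, e * a = a * e) : ∃ α : k, Nonempty (PeirceAlg α ≃ₐ[k] E) := by
  have := h.finite
  obtain ⟨φ, hφ⟩ := h.exists_functional
  have hl : ∀ a : E, a ≠ 0 → ∃ b, φ (a * b) ≠ 0 := fun a ha => (hφ a ha).1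
  have hf : (1 - e) * (1 - e) = 1 - e := by
    rw [mul_sub, mul_one, sub_mul, he, one_mul, sub_self, sub_zero]
  have hiff : (∀ a, e * a * (1 - e) = 0) ↔ ∀ a, (1 - e) * a * e = 0 := by
    refine ⟨peirce_eq_zero_of_peirce_eq_zero hl he, fun H a => ?_⟩
    have := peirce_eq_zero_of_peirce_eq_zero hl hf (by simpa using H) a
    simpa using this
  -- If one corner vanished, so would the other. Then `ea = eae = ae` for every `a`, and `e` would
  -- be central.
  have hx : ¬ ∀ a, e * a * (1 - e) = 0 := by
    intro H
    refine hc fun a => ?_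
    have h1 := H a
    have h2 := hiff.1 H a
    rw [mul_sub, mul_one, sub_eq_zero] at h1
    rw [sub_mul, one_mul, sub_mul, sub_eq_zero] at h2
    rw [h1, h2]
  have hy := hx ∘ hiff.2
  push Not at hx
  obtain ⟨x, hx⟩ := hx
  obtain ⟨y, hy⟩ := not_forall.1 hy
  refine exists_peirceAlg_equiv he ?_ ?_ hx hy ?_ ?_ ?_ ?_ hE
  · rintro rfl
    simp at hx
  · rintro rfl
    simp at hx
  · rw [← mul_assoc, ← mul_assoc, he]
  · rw [mul_assoc, sub_mul, one_mul, he, sub_self, mul_zero]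
  · rw [← mul_assoc, ← mul_assoc, mul_sub, mul_one, he, sub_self, zero_mul, zero_mul]
  · rw [mul_assoc, he]

variable [IsAlgClosed k]

/-- Frobenius algebras of dimension at most 3 are monogenic. -/
theorem IsFrobeniusAlgebra.isMonogenic_of_finrank_le_three (n : ℕ) :
    ∀ (E : Type v) [Ring E] [Algebra k E], Module.finrank k E = n → n ≤ 3 → Nontrivial E →
      IsFrobeniusAlgebra k E → IsMonogenic k E := by
  induction n using Nat.strong_induction_on with
  | _ n ih =>
  intro E _ _ hn hn3 _ h
  have := h.finite
  by_cases hid : ∀ e : E, e * e = e → e = 0 ∨ e = 1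
  · obtain ⟨φ, hφ⟩ := h.exists_functional
    exact isMonogenic_of_local_of_finrank_le_three (isUnit_or_isNilpotent_of_idempotents (k := k) hid)
      (fun a ha => (hφ a ha).1) (hn.trans_le hn3)
  · push Not at hid
    obtain ⟨e, he, h0, h1⟩ := hid
    by_cases hc : ∀ a, e * a = a * e
    · obtain ⟨A, B, _, _, _, _, hA, hB, hA1, hB1, ⟨f⟩⟩ := exists_prod_equiv_of_central h he hc h0 h1
      have := hA.finite
      have := hB.finite
      have hrank := f.toLinearEquiv.finrank_eq
      rw [Module.finrank_prod, hn] at hrank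
      have hA0 : 0 < Module.finrank k A := Module.finrank_pos
      have hB0 : 0 < Module.finrank k B := Module.finrank_pos
      exact .of_equiv f.symm ((ih _ (by omega) A rfl (by omega) hA1 hA).prod
        (ih _ (by omega) B rfl (by omega) hB1 hB))
    -- A noncentral idempotent would force dimension 4.
    · obtain ⟨α, ⟨f⟩⟩ := exists_peirceAlg_equiv_of_not_central h (by omega) he hc
      have := f.toLinearEquiv.finrank_eq
      rw [PeirceAlg.finrank_eq] at this
      omega

/-- A local Frobenius algebra of dimension 4 is monogenic or given by a bilinear form. -/
lemma isMonogenic_or_exists_formAlg_equiv {E : Type v} [Ring E] [Algebra k E] [Nontrivial E]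
    (h : IsFrobeniusAlgebra k E) (hE : Module.finrank k E = 4)
    (hR : ∀ a : E, IsUnit a ∨ IsNilpotent a) :
    IsMonogenic k E ∨ ∃ p q r s : k, Nonempty (FormAlg p q r s ≃ₐ[k] E) := by
  have := h.finite
  obtain ⟨φ, hφ⟩ := h.exists_functional
  have hJ := finrank_nilpotents (k := k) (hR := hR)
  have hmono := isMonogenic_of_finrank_nilpotents_le (k := k) (hR := hR)
  have hle1 := finrank_nilpotents_le_one (hR := hR) fun a ha => (hφ a ha).1
  set J := nilpotents k hR
  -- Here `dim J = 3`. If `dim J² ≥ 2`, one generator suffices, and `J² = 0` would bound `dim J` by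
  -- 1. So `J²` is a line `kz` otherwise.
  by_cases h2 : 2 ≤ Module.finrank k (J * J : Submodule k E)
  · exact Or.inl (hmono (by omega))
  right
  have hne : J * J ≠ ⊥ := by
    intro hbot
    have := hle1 hbot
    omega
  have h1 : Module.finrank k (J * J : Submodule k E) = 1 := by
    have := Submodule.one_le_finrank_iff.2 hne
    omega
  obtain ⟨⟨z, hz⟩, hz0, hspan⟩ := finrank_eq_one_iff'.1 h1
  have hz0 : z ≠ 0 := fun h => hz0 (Subtype.ext h)
  have hspan : ∀ a ∈ J * J, ∃ c : k, c • z = a := fun a ha => by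
    obtain ⟨c, hc⟩ := hspan ⟨a, ha⟩
    exact ⟨c, congrArg Subtype.val hc⟩
  have hJJ : J * J ≤ J := nilpotents_mul_self_le
  have hzJ : z ∈ J := hJJ hz
  have hmul : ∀ a ∈ J, ∀ b ∈ J, ∃ c : k, a * b = c • z := fun a ha b hb => by
    obtain ⟨c, hc⟩ := hspan _ (Submodule.mul_mem_mul ha hb)
    exact ⟨c, hc.symm⟩
  -- Since `az` lies in `J² = kz`, `z` is an eigenvector of multiplication by `a`. The eigenvalue is
  -- 0 because `a` is nilpotent.
  have hJz : ∀ a ∈ J, a * z = 0 := by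
    intro a ha
    obtain ⟨c, hc⟩ := hmul a ha z hzJ
    obtain ⟨n, hn⟩ := mem_nilpotents.1 ha
    have hpow : ∀ m : ℕ, a ^ m * z = c ^ m • z := by
      intro m
      induction m with
      | zero => simp
      | succ m ih => rw [pow_succ, mul_assoc, hc, mul_smul_comm, ih, smul_smul, pow_succ']
    have := hpow n
    rw [hn, zero_mul] at this
    have hc0 : c = 0 := IsNilpotent.eq_zero ⟨n, (smul_eq_zero.1 this.symm).resolve_right hz0⟩
    rw [hc, hc0, zero_smul]
  have hzJ' : ∀ a ∈ J, z * a = 0 := by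
    intro a ha
    obtain ⟨c, hc⟩ := hmul z hzJ a ha
    obtain ⟨n, hn⟩ := mem_nilpotents.1 ha
    have hpow : ∀ m : ℕ, z * a ^ m = c ^ m • z := by
      intro m
      induction m with
      | zero => simp
      | succ m ih => rw [pow_succ', ← mul_assoc, hc, smul_mul_assoc, ih, smul_smul, pow_succ']
    have := hpow n
    rw [hn, mul_zero] at this
    have hc0 : c = 0 := IsNilpotent.eq_zero ⟨n, (smul_eq_zero.1 this.symm).resolve_right hz0⟩
    rw [hc, hc0, zero_smul]
  have hz1 : Module.finrank k (k ∙ z) = 1 := finrank_span_singleton hz0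
  obtain ⟨x, hx, hxz⟩ : ∃ x ∈ J, x ∉ k ∙ z := by
    refine SetLike.not_le_iff_exists.1 fun hle => ?_
    have := Submodule.finrank_mono hle
    omega
  have hx1 : Module.finrank k (k ∙ x) = 1 := finrank_span_singleton fun h => hxz (h ▸ zero_mem _)
  obtain ⟨y, hy, hyxz⟩ : ∃ y ∈ J, y ∉ (k ∙ x) ⊔ (k ∙ z) := by
    refine SetLike.not_le_iff_exists.1 fun hle => ?_
    have h3 := Submodule.finrank_mono hle
    have h4 := Submodule.finrank_add_le_finrank_add_finrank (k ∙ x) (k ∙ z)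
    omega
  obtain ⟨p, hp⟩ := hmul x hx x hx
  obtain ⟨q, hq⟩ := hmul x hx y hy
  obtain ⟨r, hr⟩ := hmul y hy x hx
  obtain ⟨s, hs⟩ := hmul y hy y hy
  let F : FormAlg p q r s →ₐ[k] E := FormAlg.lift x y z hp hq hr hs (hJz x hx) (hzJ' x hx)
    (hJz y hy) (hzJ' y hy) (hJz z hzJ)
  have hF : Function.Injective F := by
    rw [injective_iff_map_eq_zero]
    intro u hu
    obtain ⟨a, b, c, d, rfl⟩ := FormAlg.mk_surj u
    have hsum : a • (1 : E) + b • x + c • y + d • z = 0 := hu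
    have ha : a = 0 := by
      by_contra ha
      refine one_notMem_nilpotents (k := k) (hR := hR) ?_
      have h5 : (1 : E) = a⁻¹ • (-(b • x + c • y + d • z)) := by
        rw [eq_inv_smul_iff₀ ha, eq_neg_iff_add_eq_zero, ← hsum]
        abel
      rw [h5]
      exact J.smul_mem _ (J.neg_mem (J.add_mem (J.add_mem (J.smul_mem _ hx) (J.smul_mem _ hy))
        (J.smul_mem _ hzJ)))
    subst ha
    have hc : c = 0 := by
      by_contra hc
      refine hyxz ?_
      have h5 : y = c⁻¹ • (-(b • x + d • z)) := by
        rw [eq_inv_smul_iff₀ hc, eq_neg_iff_add_eq_zero, ← hsum, zero_smul]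
        abel
      rw [h5]
      exact Submodule.smul_mem _ _ (Submodule.neg_mem _ (Submodule.add_mem_sup
        (Submodule.smul_mem _ _ (Submodule.mem_span_singleton_self x))
        (Submodule.smul_mem _ _ (Submodule.mem_span_singleton_self z))))
    subst hc
    have hb : b = 0 := by
      by_contra hb
      refine hxz ?_
      have h5 : x = b⁻¹ • (-(d • z)) := by
        rw [eq_inv_smul_iff₀ hb, eq_neg_iff_add_eq_zero, ← hsum, zero_smul, zero_smul]
        abel
      rw [h5]
      exact Submodule.smul_mem _ _ (Submodule.neg_mem _
        (Submodule.smul_mem _ _ (Submodule.mem_span_singleton_self z)))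
    subst hb
    rw [zero_smul, zero_smul, zero_smul, zero_add, zero_add, zero_add] at hsum
    rw [(smul_eq_zero.1 hsum).resolve_right hz0, FormAlg.zero_def]
  exact ⟨p, q, r, s, ⟨AlgEquiv.ofBijective F ⟨hF,
    (LinearMap.injective_iff_surjective_of_finrank_eq_finrank
      (FormAlg.finrank_eq.trans hE.symm) (f := F.toLinearMap)).1 hF⟩⟩⟩

/-- Every Frobenius algebra of dimension 4 is isomorphic to an algebra in the table. -/
theorem FrobeniusTable.exists_of_isFrobeniusAlgebra [CharZero k] (E : Type v) [Ring E]
    [Algebra k E] (hE : Module.finrank k E = 4) (h : IsFrobeniusAlgebra k E) :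
    ∃ t : FrobeniusTable k, Nonempty (E ≃ₐ[k] t.alg) := by
  have := h.finite
  have : Nontrivial E := Module.nontrivial_of_finrank_pos (R := k) (by omega)
  by_cases hid : ∀ e : E, e * e = e → e = 0 ∨ e = 1
  · rcases isMonogenic_or_exists_formAlg_equiv h hE
      (isUnit_or_isNilpotent_of_idempotents (k := k) hid) with hm | ⟨p, q, r, s, ⟨f⟩⟩
    · exact exists_of_isMonogenic hE hm
    · have hdet := FormAlg.det_ne_zero_of_isFrobeniusAlgebra (.of_equiv f.symm h)
      rcases FormAlg.exists_normal_form hdet with ⟨⟨g⟩⟩ | ⟨lam, h0, ⟨g⟩⟩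
      · obtain ⟨g'⟩ := nonempty_skewJordan_equiv k
        exact ⟨jordan, ⟨(f.symm.trans g).trans g'.symm⟩⟩
      · by_cases h1 : lam = 1
        · subst h1
          obtain ⟨g'⟩ := nonempty_commutativeSquares_equiv k
          have e : E ≃ₐ[k] CommutativeSquares k := (f.symm.trans g).trans g'.symm
          exact ⟨squares, ⟨e⟩⟩
        · obtain ⟨g'⟩ := nonempty_skewSquares_equiv k lam
          exact ⟨skew lam h0 h1, ⟨(f.symm.trans g).trans g'.symm⟩⟩
  · push Not at hid
    obtain ⟨e, he, h0, h1⟩ := hid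
    by_cases hc : ∀ a, e * a = a * e
    · obtain ⟨A, B, _, _, _, _, hA, hB, hA1, hB1, ⟨f⟩⟩ := exists_prod_equiv_of_central h he hc h0 h1
      have := hA.finite
      have := hB.finite
      have hrank := f.toLinearEquiv.finrank_eq
      rw [Module.finrank_prod, hE] at hrank
      have hA0 : 0 < Module.finrank k A := Module.finrank_pos
      have hB0 : 0 < Module.finrank k B := Module.finrank_pos
      -- Both factors are nonzero, so each has dimension at most 3 and is generated by one element.
      exact exists_of_isMonogenic hE (.of_equiv f.symm
        ((hA.isMonogenic_of_finrank_le_three _ A rfl (by omega) hA1).prod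
          (hB.isMonogenic_of_finrank_le_three _ B rfl (by omega) hB1)))
    · obtain ⟨α, ⟨f⟩⟩ := exists_peirceAlg_equiv_of_not_central h (by omega) he hc
      by_cases hα : α = 0
      · subst hα
        obtain ⟨g⟩ := TwoCycle.nonempty_twoCycleAlgebra_equiv k
        exact ⟨twoCycle, ⟨f.symm.trans g.symm⟩⟩
      · obtain ⟨g⟩ := nonempty_matrix_equiv k hα
        exact ⟨matrix, ⟨f.symm.trans g.symm⟩⟩

end Classification

/-! ### Dimension, Frobenius property and commutativity of the entries -/

section TableFacts

variable {k : Type u} [Field k]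

lemma IsMonogenic.truncatedPolynomial (n : ℕ) : IsMonogenic k (TruncatedPolynomial k n) :=
  ⟨Ideal.Quotient.mk _ X + algebraMap k _ 0, by
    rw [TruncatedPolynomial.finrank_eq, TruncatedPolynomial.minpoly_eq, natDegree_pow,
      natDegree_X_sub_C, mul_one]⟩

lemma IsMonogenic.self : IsMonogenic k k :=
  ⟨0, by rw [minpoly.eq_X_sub_C', natDegree_X_sub_C, Module.finrank_self]⟩

lemma IsMonogenic.fin [CharZero k] (n : ℕ) : IsMonogenic k (Fin n → k) := by
  refine ⟨fun i => ((i : ℕ) : k), ?_⟩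
  rw [minpoly_pi _ fun i j h => Fin.ext (Nat.cast_injective h),
    natDegree_prod_of_monic _ _ fun i _ => monic_X_sub_C _]
  simp only [natDegree_X_sub_C]
  simp

lemma FormAlg.not_commutative {p q r s : k} (h : q ≠ r) :
    ¬ ∀ u v : FormAlg p q r s, u * v = v * u := by
  intro H
  have := H (mk 0 1 0 0) (mk 0 0 1 0)
  simp [mk_mul, mk_inj] at this
  exact h this

lemma PeirceAlg.not_commutative (α : k) : ¬ ∀ u v : PeirceAlg α, u * v = v * u := by
  intro H
  have := H (mk 1 0 0 0) (mk 0 0 1 0)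
  simp [mk_mul, mk_inj] at this

lemma commutative_of_equiv {A : Type v} {B : Type w} [Ring A] [Ring B] [Algebra k A] [Algebra k B]
    (f : A ≃ₐ[k] B) (h : ∀ a b : A, a * b = b * a) (a b : B) : a * b = b * a := by
  apply f.symm.injective
  rw [map_mul, map_mul, h]

namespace FrobeniusTable

lemma finrank_eq_four_and_isFrobeniusAlgebra [IsAlgClosed k] [CharZero k] (t : FrobeniusTable k) :
    Module.finrank k t.alg = 4 ∧ IsFrobeniusAlgebra k t.alg := by
  have hfin := fun n => TruncatedPolynomial.finite (k := k) n
  have htr := fun n => TruncatedPolynomial.finrank_eq (k := k) n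
  have hmon := fun n => IsMonogenic.truncatedPolynomial (k := k) n
  have hform : ∀ {A : Type u} [Ring A] [Algebra k A] {p q r s : k}, p * s - q * r ≠ 0 →
      Nonempty (A ≃ₐ[k] FormAlg p q r s) → Module.finrank k A = 4 ∧ IsFrobeniusAlgebra k A := by
    rintro A _ _ p q r s h ⟨f⟩
    exact ⟨f.toLinearEquiv.finrank_eq.trans FormAlg.finrank_eq,
      .of_equiv f.symm (FormAlg.isFrobeniusAlgebra h)⟩
  have hpeirce : ∀ {A : Type u} [Ring A] [Algebra k A] {α : k},
      Nonempty (A ≃ₐ[k] PeirceAlg α) → Module.finrank k A = 4 ∧ IsFrobeniusAlgebra k A := by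
    rintro A _ _ α ⟨f⟩
    exact ⟨f.toLinearEquiv.finrank_eq.trans PeirceAlg.finrank_eq,
      .of_equiv f.symm (PeirceAlg.isFrobeniusAlgebra α)⟩
  cases t with
  | split =>
    have h1 : Module.finrank k (Fin 4 → k) = 4 := by simp
    exact ⟨h1, (IsMonogenic.fin 4).isFrobeniusAlgebra⟩
  | splitDual =>
    have h1 : Module.finrank k ((Fin 2 → k) × TruncatedPolynomial k 2) = 4 := by
      rw [Module.finrank_prod, htr]
      simp
    exact ⟨h1, ((IsMonogenic.fin 2).prod (hmon 2)).isFrobeniusAlgebra⟩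
  | splitCubic =>
    have h1 : Module.finrank k (k × TruncatedPolynomial k 3) = 4 := by
      rw [Module.finrank_prod, htr, Module.finrank_self]
    exact ⟨h1, (IsMonogenic.self.prod (hmon 3)).isFrobeniusAlgebra⟩
  | dualDual =>
    have h1 : Module.finrank k (TruncatedPolynomial k 2 × TruncatedPolynomial k 2) = 4 := by
      rw [Module.finrank_prod, htr]
    exact ⟨h1, ((hmon 2).prod (hmon 2)).isFrobeniusAlgebra⟩
  | quartic => exact ⟨htr 4, (hmon 4).isFrobeniusAlgebra⟩
  | squares => exact hform (by simp) (nonempty_commutativeSquares_equiv k)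
  | matrix => exact hpeirce (nonempty_matrix_equiv k one_ne_zero)
  | twoCycle => exact hpeirce (TwoCycle.nonempty_twoCycleAlgebra_equiv k)
  | jordan => exact hform (by simp) (nonempty_skewJordan_equiv k)
  | skew lam h0 h1 => exact hform (by simpa using h0) (nonempty_skewSquares_equiv k lam)

lemma commutative_iff_inCommutativeHalf [CharZero k] (t : FrobeniusTable k) :
    (∀ a b : t.alg, a * b = b * a) ↔ t.InCommutativeHalf := by
  cases t with
  | split => exact iff_of_true (fun a b : Fin 4 → k => mul_comm a b) trivial
  | splitDual =>
    exact iff_of_true (fun a b : (Fin 2 → k) × TruncatedPolynomial k 2 => mul_comm a b) trivial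
  | splitCubic => exact iff_of_true (fun a b : k × TruncatedPolynomial k 3 => mul_comm a b) trivial
  | dualDual =>
    exact iff_of_true
      (fun a b : TruncatedPolynomial k 2 × TruncatedPolynomial k 2 => mul_comm a b) trivial
  | quartic => exact iff_of_true (fun a b : TruncatedPolynomial k 4 => mul_comm a b) trivial
  | squares => exact iff_of_true (fun a b : CommutativeSquares k => mul_comm a b) trivial
  | matrix =>
    obtain ⟨f⟩ := nonempty_matrix_equiv k (one_ne_zero (α := k))
    exact iff_of_false (fun h => PeirceAlg.not_commutative 1 (commutative_of_equiv f h)) id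
  | twoCycle =>
    obtain ⟨f⟩ := TwoCycle.nonempty_twoCycleAlgebra_equiv k
    exact iff_of_false (fun h => PeirceAlg.not_commutative 0 (commutative_of_equiv f h)) id
  | jordan =>
    obtain ⟨f⟩ := nonempty_skewJordan_equiv k
    exact iff_of_false
      (fun h => FormAlg.not_commutative (by norm_num) (commutative_of_equiv f h)) id
  | skew lam h0 h1 =>
    obtain ⟨f⟩ := nonempty_skewSquares_equiv k lam
    exact iff_of_false (fun h => FormAlg.not_commutative h1 (commutative_of_equiv f h)) id

end FrobeniusTable

end TableFacts

/-! ### Isomorphism invariants -/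

section Invariants

/-- There is a nilpotent element whose `n`-th power does not vanish. -/
def HasNilpotentPow (n : ℕ) (A : Type v) [Ring A] : Prop := ∃ x : A, IsNilpotent x ∧ x ^ n ≠ 0

/-- There is a nonzero idempotent that kills all nilpotent elements. -/
def HasReducedIdempotent (A : Type v) [Ring A] : Prop :=
  ∃ e : A, e * e = e ∧ e ≠ 0 ∧ ∀ x, IsNilpotent x → e * x = 0

/-- There is an idempotent other than `0` and `1`. -/
def HasNontrivialIdempotent (A : Type v) [Ring A] : Prop := ∃ e : A, e * e = e ∧ e ≠ 0 ∧ e ≠ 1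

/-- There is an element of square zero that generates an ideal whose square does not vanish. -/
def HasRegularSquareZero (A : Type v) [Ring A] : Prop := ∃ x y : A, x * x = 0 ∧ x * y * x ≠ 0

variable {A : Type v} {B : Type w} [Ring A] [Ring B]

lemma HasNilpotentPow.of_equiv {n : ℕ} (f : A ≃+* B) (h : HasNilpotentPow n A) :
    HasNilpotentPow n B := by
  obtain ⟨x, hx, hx'⟩ := h
  exact ⟨f x, hx.map f, by rwa [← map_pow, map_ne_zero_iff _ f.injective]⟩

lemma HasReducedIdempotent.of_equiv (f : A ≃+* B) (h : HasReducedIdempotent A) :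
    HasReducedIdempotent B := by
  obtain ⟨e, he, h0, h⟩ := h
  refine ⟨f e, by rw [← map_mul, he], by rwa [map_ne_zero_iff _ f.injective], fun x hx => ?_⟩
  rw [← f.apply_symm_apply x, ← map_mul, h _ (hx.map f.symm), map_zero]

lemma HasNontrivialIdempotent.of_equiv (f : A ≃+* B) (h : HasNontrivialIdempotent A) :
    HasNontrivialIdempotent B := by
  obtain ⟨e, he, h0, h1⟩ := h
  exact ⟨f e, by rw [← map_mul, he], by rwa [map_ne_zero_iff _ f.injective],
    by rwa [map_ne_one_iff _ f.injective]⟩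

lemma HasRegularSquareZero.of_equiv (f : A ≃+* B) (h : HasRegularSquareZero A) :
    HasRegularSquareZero B := by
  obtain ⟨x, y, hx, hxy⟩ := h
  exact ⟨f x, f y, by rw [← map_mul, hx, map_zero],
    by rwa [← map_mul, ← map_mul, map_ne_zero_iff _ f.injective]⟩

lemma HasNilpotentPow.prod_right {n : ℕ} (h : HasNilpotentPow n B) :
    HasNilpotentPow n (A × B) := by
  obtain ⟨x, ⟨m, hm⟩, hx⟩ := h
  refine ⟨(0, x), ⟨m + 1, ?_⟩, fun h => hx (congrArg Prod.snd h)⟩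
  rw [Prod.pow_mk, zero_pow m.succ_ne_zero, pow_succ, hm, zero_mul]
  rfl

lemma not_hasNilpotentPow_prod {n : ℕ} (hA : ¬ HasNilpotentPow n A) (hB : ¬ HasNilpotentPow n B) :
    ¬ HasNilpotentPow n (A × B) := by
  rintro ⟨⟨x, y⟩, hxy, h⟩
  have hx : IsNilpotent x := hxy.map (RingHom.fst A B)
  have hy : IsNilpotent y := hxy.map (RingHom.snd A B)
  refine h (Prod.ext ?_ ?_)
  · by_contra h0
    exact hA ⟨x, hx, h0⟩
  · by_contra h0
    exact hB ⟨y, hy, h0⟩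

lemma not_hasNilpotentPow_of_isReduced [IsReduced A] {n : ℕ} (hn : n ≠ 0) :
    ¬ HasNilpotentPow n A := by
  rintro ⟨x, hx, h⟩
  rw [hx.eq_zero, zero_pow hn] at h
  exact h rfl

lemma hasReducedIdempotent_of_isReduced [IsReduced A] [Nontrivial A] : HasReducedIdempotent A :=
  ⟨1, mul_one 1, one_ne_zero, fun x hx => by rw [hx.eq_zero, mul_zero]⟩

lemma HasReducedIdempotent.prod_left (h : HasReducedIdempotent A) :
    HasReducedIdempotent (A × B) := by
  obtain ⟨e, he, h0, h⟩ := h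
  refine ⟨(e, 0), Prod.ext he (mul_zero 0), fun h => h0 (congrArg Prod.fst h), fun x hx => ?_⟩
  exact Prod.ext (h _ (hx.map (RingHom.fst A B))) (zero_mul _)

lemma not_hasReducedIdempotent_prod (hA : ¬ HasReducedIdempotent A)
    (hB : ¬ HasReducedIdempotent B) : ¬ HasReducedIdempotent (A × B) := by
  rintro ⟨⟨e, f⟩, he, h0, h⟩
  refine h0 (Prod.ext ?_ ?_)
  · by_contra h1
    refine hA ⟨e, congrArg Prod.fst he, h1, fun x hx => congrArg Prod.fst (h (x, 0) ?_)⟩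
    obtain ⟨m, hm⟩ := hx
    refine ⟨m + 1, ?_⟩
    rw [Prod.pow_mk, zero_pow m.succ_ne_zero, pow_succ, hm, zero_mul]
    rfl
  · by_contra h1
    refine hB ⟨f, congrArg Prod.snd he, h1, fun x hx => congrArg Prod.snd (h (0, x) ?_)⟩
    obtain ⟨m, hm⟩ := hx
    refine ⟨m + 1, ?_⟩
    rw [Prod.pow_mk, zero_pow m.succ_ne_zero, pow_succ, hm, zero_mul]
    rfl

variable {k : Type u} [Field k]

namespace TruncatedPolynomial

lemma mk_eq_zero_iff {n : ℕ} {q : k[X]} :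
    (Ideal.Quotient.mk _ q : TruncatedPolynomial k n) = 0 ↔ X ^ n ∣ q := by
  rw [Ideal.Quotient.eq_zero_iff_mem, Ideal.mem_span_singleton]

lemma hasNilpotentPow {m n : ℕ} (h : m < n) : HasNilpotentPow m (TruncatedPolynomial k n) := by
  refine ⟨Ideal.Quotient.mk _ X, ⟨n, ?_⟩, ?_⟩
  · rw [← map_pow, mk_eq_zero_iff]
  · rw [← map_pow, Ne, mk_eq_zero_iff, pow_dvd_pow_iff X_ne_zero not_isUnit_X]
    omega

lemma not_hasNilpotentPow {m n : ℕ} (h : n ≤ m) :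
    ¬ HasNilpotentPow m (TruncatedPolynomial k n) := by
  rintro ⟨x, ⟨l, hl⟩, hx⟩
  obtain ⟨q, rfl⟩ := Ideal.Quotient.mk_surjective x
  rw [← map_pow, Ne, mk_eq_zero_iff] at hx
  rw [← map_pow, mk_eq_zero_iff] at hl
  rcases Nat.eq_zero_or_pos n with rfl | hn
  · exact hx (by simp)
  · have h1 : X ∣ q := prime_X.dvd_of_dvd_pow ((dvd_pow_self X hn.ne').trans hl)
    exact hx ((pow_dvd_pow X h).trans (pow_dvd_pow_of_dvd h1 m))

/-- If `e` kills the nilpotent `X`, then `X` divides a representative of `e`. So `e` is nilpotent as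
well as idempotent, hence 0. -/
lemma not_hasReducedIdempotent {n : ℕ} (hn : 2 ≤ n) :
    ¬ HasReducedIdempotent (TruncatedPolynomial k n) := by
  rintro ⟨e, he, h0, h⟩
  have hX := h (Ideal.Quotient.mk _ X) ⟨n, by rw [← map_pow, mk_eq_zero_iff]⟩
  obtain ⟨q, rfl⟩ := Ideal.Quotient.mk_surjective e
  rw [← map_mul, mk_eq_zero_iff] at hX
  have h1 : X ∣ q := by
    obtain ⟨m, rfl⟩ := Nat.exists_eq_add_of_le' hn
    rw [show m + 2 = (m + 1) + 1 from rfl, pow_succ, mul_dvd_mul_iff_right X_ne_zero] at hX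
    exact (dvd_pow_self X m.succ_ne_zero).trans hX
  refine h0 ?_
  have h2 : (Ideal.Quotient.mk _ q : TruncatedPolynomial k n) ^ n = 0 := by
    rw [← map_pow, mk_eq_zero_iff]
    exact pow_dvd_pow_of_dvd h1 n
  have h3 : IsIdempotentElem (Ideal.Quotient.mk _ q : TruncatedPolynomial k n) := he
  obtain ⟨m, rfl⟩ := Nat.exists_eq_add_of_le' (show 1 ≤ n by omega)
  rwa [h3.pow_succ_eq] at h2

end TruncatedPolynomial

namespace FormAlg

variable {p q r s : k}

lemma eq_zero_of_isNilpotent_mk {a b c d : k} (h : IsNilpotent (mk a b c d : FormAlg p q r s)) :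
    a = 0 := by
  obtain ⟨n, hn⟩ := h
  have hpow : ∀ m : ℕ, ∃ b' c' d', (mk a b c d : FormAlg p q r s) ^ m = mk (a ^ m) b' c' d' := by
    intro m
    induction m with
    | zero => exact ⟨0, 0, 0, by rw [pow_zero, pow_zero, one_def]⟩
    | succ m ih =>
      obtain ⟨b', c', d', ih⟩ := ih
      rw [pow_succ, ih, mk_mul, pow_succ]
      exact ⟨_, _, _, rfl⟩
  obtain ⟨b', c', d', h⟩ := hpow n
  rw [hn, zero_def, mk_inj] at h
  exact IsNilpotent.eq_zero ⟨n, h.1.symm⟩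

lemma mk_zero_pow_three (b c d : k) : (mk 0 b c d : FormAlg p q r s) ^ 3 = 0 := by
  rw [pow_succ, pow_two, mk_mul, mk_mul, zero_def, mk_inj]
  simp

lemma isNilpotent_mk_zero (b c d : k) : IsNilpotent (mk 0 b c d : FormAlg p q r s) :=
  ⟨3, mk_zero_pow_three b c d⟩

lemma not_hasNilpotentPow_three : ¬ HasNilpotentPow 3 (FormAlg p q r s) := by
  rintro ⟨x, hx, h⟩
  obtain ⟨a, b, c, d, rfl⟩ := mk_surj x
  obtain rfl := eq_zero_of_isNilpotent_mk hx
  exact h (mk_zero_pow_three b c d)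

lemma hasNilpotentPow_two (h : p + q + r + s ≠ 0) : HasNilpotentPow 2 (FormAlg p q r s) := by
  refine ⟨mk 0 1 1 0, isNilpotent_mk_zero _ _ _, ?_⟩
  rw [pow_two, mk_mul, zero_def, Ne, mk_inj]
  simpa using h

/-- The scalar part of an idempotent is 0 or 1. So `e` or `1 - e` is a nilpotent idempotent and
vanishes. -/
lemma not_hasNontrivialIdempotent : ¬ HasNontrivialIdempotent (FormAlg p q r s) := by
  rintro ⟨e, he, h0, h1⟩
  have key : ∀ e : FormAlg p q r s, e * e = e → IsNilpotent e → e = 0 := by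
    rintro e he ⟨n, hn⟩
    have h3 : IsIdempotentElem e := he
    rw [← h3.pow_succ_eq n, pow_succ, hn, zero_mul]
  obtain ⟨a, b, c, d, rfl⟩ := mk_surj e
  have he' := he
  rw [mk_mul, mk_inj] at he'
  have ha : a * (a - 1) = 0 := by linear_combination he'.1
  rcases mul_eq_zero.1 ha with rfl | ha
  · exact h0 (key _ he (isNilpotent_mk_zero _ _ _))
  · obtain rfl := sub_eq_zero.1 ha
    refine h1 (sub_eq_zero.1 (key (1 - mk 1 b c d) ?_ ?_)).symm
    · rw [mul_sub, mul_one, sub_mul, he, one_mul, sub_self, sub_zero]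
    · have : (1 - mk 1 b c d : FormAlg p q r s) = mk 0 (-b) (-c) (-d) := by
        rw [sub_eq_iff_eq_add, one_def, mk_add, mk_inj]
        simp
      rw [this]
      exact isNilpotent_mk_zero _ _ _

lemma not_hasReducedIdempotent : ¬ HasReducedIdempotent (FormAlg p q r s) := by
  rintro ⟨e, he, h0, h⟩
  by_cases h1 : e = 1
  · have := h (mk 0 0 0 1) (isNilpotent_mk_zero _ _ _)
    rw [h1, one_mul, zero_def, mk_inj] at this
    exact one_ne_zero this.2.2.2
  · exact not_hasNontrivialIdempotent ⟨e, he, h0, h1⟩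

/-- Isomorphic algebras come from congruent forms. -/
lemma exists_congruent {p' q' r' s' : k} (hr : r ≠ 0)
    (f : FormAlg p q r s ≃ₐ[k] FormAlg p' q' r' s') :
    ∃ a b c d t : k, t ≠ 0 ∧
      p' * a * a + q' * a * b + r' * b * a + s' * b * b = p * t ∧
      p' * a * c + q' * a * d + r' * b * c + s' * b * d = q * t ∧
      p' * c * a + q' * c * b + r' * d * a + s' * d * b = r * t ∧
      p' * c * c + q' * c * d + r' * d * c + s' * d * d = s * t := by
  obtain ⟨a0, a, b, a1, hx⟩ := mk_surj (f (mk 0 1 0 0))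
  obtain ⟨c0, c, d, c1, hy⟩ := mk_surj (f (mk 0 0 1 0))
  obtain ⟨z0, z1, z2, t, hz⟩ := mk_surj (f (mk 0 0 0 1))
  -- Isomorphisms preserve nilpotents, so the images of `x` and `y` have no scalar part. Their `x`
  -- and `y` coordinates give the base change, and the `z` coordinate of the image of `z` gives the
  -- scale `t`.
  obtain rfl : a0 = 0 := eq_zero_of_isNilpotent_mk
    (hx ▸ (isNilpotent_mk_zero (1 : k) 0 0).map f)
  obtain rfl : c0 = 0 := eq_zero_of_isNilpotent_mk
    (hy ▸ (isNilpotent_mk_zero (0 : k) 1 0).map f)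
  have hxx := map_mul f (mk 0 1 0 0) (mk 0 1 0 0)
  have hxy := map_mul f (mk 0 1 0 0) (mk 0 0 1 0)
  have hyx := map_mul f (mk 0 0 1 0) (mk 0 1 0 0)
  have hyy := map_mul f (mk 0 0 1 0) (mk 0 0 1 0)
  have hmk : ∀ u : k, (mk 0 0 0 u : FormAlg p q r s) = u • mk 0 0 0 1 := fun u => by
    rw [smul_mk, mk_inj]
    simp
  rw [hx, mk_mul, mk_mul] at hxx
  rw [hx, hy, mk_mul, mk_mul] at hxy
  rw [hx, hy, mk_mul, mk_mul] at hyx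
  rw [hy, mk_mul, mk_mul] at hyy
  simp only [mul_zero, zero_mul, add_zero, zero_add, mul_one] at hxx hxy hyx hyy
  rw [hmk, map_smul, hz, smul_mk, mk_inj] at hxx hxy hyx hyy
  refine ⟨a, b, c, d, t, ?_, hxx.2.2.2.symm, hxy.2.2.2.symm, hyx.2.2.2.symm, hyy.2.2.2.symm⟩
  -- The image of `rz = yx` is a product of two nilpotents and hence a multiple of `z`. As `r ≠ 0`,
  -- the image of `z` would be 0 if `t` were.
  rintro rfl
  have h0 : z0 = 0 := (mul_eq_zero.1 hyx.1).resolve_left hr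
  have h1 : z1 = 0 := (mul_eq_zero.1 hyx.2.1).resolve_left hr
  have h2 : z2 = 0 := (mul_eq_zero.1 hyx.2.2.1).resolve_left hr
  rw [h0, h1, h2, ← zero_def, EmbeddingLike.map_eq_zero_iff, zero_def, mk_inj] at hz
  exact one_ne_zero hz.2.2.2

/-- A base change multiplies the antisymmetric part of a form by its determinant, and the
determinant of the form by the square of it. So `(λ - 1)²/λ` is invariant, and it determines `λ` up
to inversion. -/
lemma eq_or_eq_inv_of_equiv {lam mu : k}
    (f : FormAlg 0 lam 1 0 ≃ₐ[k] FormAlg 0 mu 1 0) : lam = mu ∨ mu = lam⁻¹ := by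
  obtain ⟨a, b, c, d, t, ht, e1, e2, e3, e4⟩ := exists_congruent one_ne_zero f
  have h2 : (mu - 1) * (a * d - b * c) = (lam - 1) * t := by linear_combination e2 - e3
  have h3 : mu * (a * d - b * c) ^ 2 = lam * t ^ 2 := by
    linear_combination e2 * (mu * c * b + d * a) + lam * t * e3 - e1 * (mu * c * d + d * c)
  have h4 : t ^ 2 * ((lam - mu) * (lam * mu - 1)) = 0 := by
    linear_combination (-(mu * ((mu - 1) * (a * d - b * c) + (lam - 1) * t))) * h2
      + (mu - 1) ^ 2 * h3
  rcases mul_eq_zero.1 ((mul_eq_zero.1 h4).resolve_left (pow_ne_zero 2 ht)) with h | h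
  · exact Or.inl (sub_eq_zero.1 h)
  · exact Or.inr (eq_inv_of_mul_eq_one_right (sub_eq_zero.1 h))

/-- The symmetric part of the Jordan form is supported on `y²` alone, and it is nonzero. If `μ = -1`
the target form is alternating, so the square of the image of `y` vanishes. If `μ ≠ -1` the
conditions `ab = 0` and `ad + bc = 0` force the scale `t` to vanish. -/
lemma not_nonempty_jordan_equiv (mu : k) :
    ¬ Nonempty (FormAlg (0 : k) (-1) 1 (-1) ≃ₐ[k] FormAlg 0 mu 1 0) := by
  rintro ⟨f⟩
  obtain ⟨a, b, c, d, t, ht, e1, e2, e3, e4⟩ := exists_congruent one_ne_zero f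
  have hmu : mu + 1 ≠ 0 := by
    intro h
    exact ht (by linear_combination e4 - c * d * h)
  have hab : a * b = 0 :=
    (mul_eq_zero.1 (by linear_combination e1 : (mu + 1) * (a * b) = 0)).resolve_left hmu
  have hsum : a * d + b * c = 0 :=
    (mul_eq_zero.1 (by linear_combination e2 + e3 :
      (mu + 1) * (a * d + b * c) = 0)).resolve_left hmu
  rcases mul_eq_zero.1 hab with rfl | rfl
  · exact ht (by linear_combination (-1 : k) * e3 + mu * hsum)
  · exact ht (by linear_combination (-1 : k) * e3 + hsum)

end FormAlg

namespace PeirceAlg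

lemma hasNontrivialIdempotent (α : k) : HasNontrivialIdempotent (PeirceAlg α) := by
  refine ⟨mk 1 0 0 0, ?_, ?_, ?_⟩
  · rw [mk_mul, mk_inj]
    simp
  · rw [zero_def, Ne, mk_inj]
    simp
  · rw [one_def, Ne, mk_inj]
    simp

lemma hasRegularSquareZero {α : k} (h : α ≠ 0) : HasRegularSquareZero (PeirceAlg α) := by
  refine ⟨mk 0 0 1 0, mk 0 0 0 1, ?_, ?_⟩
  · rw [mk_mul, zero_def, mk_inj]
    simp
  · rw [mk_mul, mk_mul, zero_def, Ne, mk_inj]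
    simpa using h

/-- For `α = 0` a square-zero element is a combination of the two arrows, and every product with two
arrow factors vanishes. -/
lemma not_hasRegularSquareZero : ¬ HasRegularSquareZero (PeirceAlg (0 : k)) := by
  rintro ⟨x, y, hx, h⟩
  obtain ⟨a, b, c, d, rfl⟩ := mk_surj x
  obtain ⟨a', b', c', d', rfl⟩ := mk_surj y
  rw [mk_mul, zero_def, mk_inj] at hx
  have ha : a = 0 := by simpa using hx.1
  have hb : b = 0 := by simpa using hx.2.1
  subst ha hb
  refine h ?_
  rw [mk_mul, mk_mul, zero_def, mk_inj]
  simp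

end PeirceAlg

end Invariants

/-! ### Separating the entries of the table -/

section Distinct

variable {k : Type u} [Field k]

namespace FrobeniusTable

/-- The entries of the commutative half with a nilpotent element of nonzero square. -/
def HasNonzeroSquare : FrobeniusTable k → Prop
  | splitCubic | quartic | squares => True
  | _ => False

/-- The entries of the commutative half with a nonzero idempotent that kills all nilpotents. -/
def HasReducedFactor : FrobeniusTable k → Prop
  | split | splitDual | splitCubic => True
  | _ => False

/-- The entries of the noncommutative half that are not local. -/
def HasIdempotent : FrobeniusTable k → Prop
  | matrix | twoCycle => True
  | _ => False

lemma hasNilpotentPow_one_iff {t : FrobeniusTable k} (ht : t.InCommutativeHalf) :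
    HasNilpotentPow 1 t.alg ↔ t ≠ split := by
  cases t with
  | split =>
    exact iff_of_false (not_hasNilpotentPow_of_isReduced (A := Fin 4 → k) one_ne_zero) (by simp)
  | splitDual =>
    exact iff_of_true (HasNilpotentPow.prod_right (A := Fin 2 → k)
      (TruncatedPolynomial.hasNilpotentPow (k := k) (n := 2) (by norm_num))) (by simp)
  | splitCubic =>
    exact iff_of_true (HasNilpotentPow.prod_right (A := k)
      (TruncatedPolynomial.hasNilpotentPow (k := k) (n := 3) (by norm_num))) (by simp)
  | dualDual =>
    exact iff_of_true (HasNilpotentPow.prod_right (A := TruncatedPolynomial k 2)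
      (TruncatedPolynomial.hasNilpotentPow (k := k) (n := 2) (by norm_num))) (by simp)
  | quartic =>
    exact iff_of_true (TruncatedPolynomial.hasNilpotentPow (k := k) (n := 4) (by norm_num))
      (by simp)
  | squares =>
    obtain ⟨f⟩ := nonempty_commutativeSquares_equiv k
    refine iff_of_true (HasNilpotentPow.of_equiv f.symm.toRingEquiv
      ⟨FormAlg.mk 0 1 0 0, FormAlg.isNilpotent_mk_zero _ _ _, ?_⟩) (by simp)
    rw [pow_one, FormAlg.zero_def, Ne, FormAlg.mk_inj]
    simp
  | matrix | twoCycle | jordan | skew => exact ht.elim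

lemma hasNilpotentPow_two_iff [CharZero k] {t : FrobeniusTable k} (ht : t.InCommutativeHalf) :
    HasNilpotentPow 2 t.alg ↔ t.HasNonzeroSquare := by
  cases t with
  | split =>
    exact iff_of_false (not_hasNilpotentPow_of_isReduced (A := Fin 4 → k) two_ne_zero) id
  | splitDual =>
    exact iff_of_false (not_hasNilpotentPow_prod
      (not_hasNilpotentPow_of_isReduced (A := Fin 2 → k) two_ne_zero)
      (TruncatedPolynomial.not_hasNilpotentPow (k := k) (n := 2) le_rfl)) id
  | splitCubic =>
    exact iff_of_true (HasNilpotentPow.prod_right (A := k)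
      (TruncatedPolynomial.hasNilpotentPow (k := k) (n := 3) (by norm_num))) trivial
  | dualDual =>
    exact iff_of_false (not_hasNilpotentPow_prod
      (TruncatedPolynomial.not_hasNilpotentPow (k := k) (n := 2) le_rfl)
      (TruncatedPolynomial.not_hasNilpotentPow (k := k) (n := 2) le_rfl)) id
  | quartic =>
    exact iff_of_true (TruncatedPolynomial.hasNilpotentPow (k := k) (n := 4) (by norm_num))
      trivial
  | squares =>
    obtain ⟨f⟩ := nonempty_commutativeSquares_equiv k
    -- The square of `x + y` is `2xy`, which is nonzero because the characteristic is not 2.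
    exact iff_of_true (HasNilpotentPow.of_equiv f.symm.toRingEquiv
      (FormAlg.hasNilpotentPow_two (by norm_num))) trivial
  | matrix | twoCycle | jordan | skew => exact ht.elim

lemma hasNilpotentPow_three_quartic :
    HasNilpotentPow 3 (quartic : FrobeniusTable k).alg :=
  TruncatedPolynomial.hasNilpotentPow (k := k) (n := 4) (by norm_num)

lemma not_hasNilpotentPow_three_squares :
    ¬ HasNilpotentPow 3 (squares : FrobeniusTable k).alg := by
  obtain ⟨f⟩ := nonempty_commutativeSquares_equiv k
  exact fun h => FormAlg.not_hasNilpotentPow_three (HasNilpotentPow.of_equiv f.toRingEquiv h)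

lemma hasReducedIdempotent_iff {t : FrobeniusTable k} (ht : t.InCommutativeHalf) :
    HasReducedIdempotent t.alg ↔ t.HasReducedFactor := by
  cases t with
  | split =>
    exact iff_of_true (hasReducedIdempotent_of_isReduced (A := Fin 4 → k)) trivial
  | splitDual =>
    exact iff_of_true (HasReducedIdempotent.prod_left (B := TruncatedPolynomial k 2)
      (hasReducedIdempotent_of_isReduced (A := Fin 2 → k))) trivial
  | splitCubic =>
    exact iff_of_true (HasReducedIdempotent.prod_left (B := TruncatedPolynomial k 3)
      (hasReducedIdempotent_of_isReduced (A := k))) trivial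
  | dualDual =>
    exact iff_of_false (not_hasReducedIdempotent_prod
      (TruncatedPolynomial.not_hasReducedIdempotent (k := k) le_rfl)
      (TruncatedPolynomial.not_hasReducedIdempotent (k := k) le_rfl)) id
  | quartic =>
    exact iff_of_false (TruncatedPolynomial.not_hasReducedIdempotent (k := k) (n := 4)
      (by norm_num)) id
  | squares =>
    obtain ⟨f⟩ := nonempty_commutativeSquares_equiv k
    exact iff_of_false
      (fun h => FormAlg.not_hasReducedIdempotent (HasReducedIdempotent.of_equiv f.toRingEquiv h)) id
  | matrix | twoCycle | jordan | skew => exact ht.elim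

lemma hasNontrivialIdempotent_iff {t : FrobeniusTable k} (ht : ¬ t.InCommutativeHalf) :
    HasNontrivialIdempotent t.alg ↔ t.HasIdempotent := by
  cases t with
  | matrix =>
    obtain ⟨f⟩ := nonempty_matrix_equiv k (one_ne_zero (α := k))
    exact iff_of_true (HasNontrivialIdempotent.of_equiv f.symm.toRingEquiv
      (PeirceAlg.hasNontrivialIdempotent 1)) trivial
  | twoCycle =>
    obtain ⟨f⟩ := TwoCycle.nonempty_twoCycleAlgebra_equiv k
    exact iff_of_true (HasNontrivialIdempotent.of_equiv f.symm.toRingEquiv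
      (PeirceAlg.hasNontrivialIdempotent 0)) trivial
  | jordan =>
    obtain ⟨f⟩ := nonempty_skewJordan_equiv k
    exact iff_of_false (fun h =>
      FormAlg.not_hasNontrivialIdempotent (HasNontrivialIdempotent.of_equiv f.toRingEquiv h)) id
  | skew lam h0 h1 =>
    obtain ⟨f⟩ := nonempty_skewSquares_equiv k lam
    exact iff_of_false (fun h =>
      FormAlg.not_hasNontrivialIdempotent (HasNontrivialIdempotent.of_equiv f.toRingEquiv h)) id
  | split | splitDual | splitCubic | dualDual | quartic | squares => exact (ht trivial).elim

lemma hasRegularSquareZero_matrix : HasRegularSquareZero (matrix : FrobeniusTable k).alg := by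
  obtain ⟨f⟩ := nonempty_matrix_equiv k (one_ne_zero (α := k))
  exact HasRegularSquareZero.of_equiv f.symm.toRingEquiv
    (PeirceAlg.hasRegularSquareZero one_ne_zero)

lemma not_hasRegularSquareZero_twoCycle :
    ¬ HasRegularSquareZero (twoCycle : FrobeniusTable k).alg := by
  obtain ⟨f⟩ := TwoCycle.nonempty_twoCycleAlgebra_equiv k
  exact fun h => PeirceAlg.not_hasRegularSquareZero (HasRegularSquareZero.of_equiv f.toRingEquiv h)

lemma not_jordan_equiv_skew (lam : k) (h0 : lam ≠ 0) (h1 : lam ≠ 1) :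
    ¬ Nonempty ((jordan : FrobeniusTable k).alg ≃ₐ[k] (skew lam h0 h1).alg) := by
  rintro ⟨e⟩
  obtain ⟨f⟩ := nonempty_skewJordan_equiv k
  obtain ⟨g⟩ := nonempty_skewSquares_equiv k lam
  exact FormAlg.not_nonempty_jordan_equiv lam ⟨(f.symm.trans e).trans g⟩

lemma eq_or_eq_inv_of_skew_equiv {lam mu : k} {h0 : lam ≠ 0} {h1 : lam ≠ 1} {h0' : mu ≠ 0}
    {h1' : mu ≠ 1} (h : Nonempty ((skew lam h0 h1).alg ≃ₐ[k] (skew mu h0' h1').alg)) :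
    lam = mu ∨ mu = lam⁻¹ := by
  obtain ⟨e⟩ := h
  obtain ⟨f⟩ := nonempty_skewSquares_equiv k lam
  obtain ⟨g⟩ := nonempty_skewSquares_equiv k mu
  exact FormAlg.eq_or_eq_inv_of_equiv ((f.symm.trans e).trans g)

lemma nonempty_skew_equiv_inv {lam : k} (h0 : lam ≠ 0) (h1 : lam ≠ 1) (h0' : lam⁻¹ ≠ 0)
    (h1' : lam⁻¹ ≠ 1) : Nonempty ((skew lam h0 h1).alg ≃ₐ[k] (skew lam⁻¹ h0' h1').alg) := by
  obtain ⟨f⟩ := nonempty_skewSquares_equiv k lam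
  obtain ⟨g⟩ := nonempty_skewSquares_equiv k lam⁻¹
  obtain ⟨e⟩ := FormAlg.nonempty_equiv_inv h0
  exact ⟨(f.trans e).trans g.symm⟩

lemma eq_of_equiv_of_inCommutativeHalf [CharZero k] {s t : FrobeniusTable k}
    (hs : s.InCommutativeHalf) (ht : t.InCommutativeHalf) (e : s.alg ≃ₐ[k] t.alg) : s = t := by
  have iffs : ∀ n, HasNilpotentPow n s.alg ↔ HasNilpotentPow n t.alg := fun n =>
    ⟨.of_equiv e.toRingEquiv, .of_equiv e.symm.toRingEquiv⟩
  have h1 := iffs 1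
  have h2 := iffs 2
  have h3 := iffs 3
  have h4 : HasReducedIdempotent s.alg ↔ HasReducedIdempotent t.alg :=
    ⟨.of_equiv e.toRingEquiv, .of_equiv e.symm.toRingEquiv⟩
  rw [hasNilpotentPow_one_iff hs, hasNilpotentPow_one_iff ht] at h1
  rw [hasNilpotentPow_two_iff hs, hasNilpotentPow_two_iff ht] at h2
  rw [hasReducedIdempotent_iff hs, hasReducedIdempotent_iff ht] at h4
  have hq := hasNilpotentPow_three_quartic (k := k)
  have hsq := not_hasNilpotentPow_three_squares (k := k)
  clear iffs e
  -- Nilpotents single out `k⁴`. Nonzero squares and reduced idempotents split the other five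
  -- entries into classes in which only `quartic` and `squares` remain together, and cubes of
  -- nilpotents separate those two.
  cases s <;> cases t <;>
    simp_all [HasNonzeroSquare, HasReducedFactor, InCommutativeHalf]

lemma eq_or_inv_of_equiv_of_not_inCommutativeHalf {s t : FrobeniusTable k}
    (hs : ¬ s.InCommutativeHalf) (ht : ¬ t.InCommutativeHalf) (e : s.alg ≃ₐ[k] t.alg) :
    s = t ∨ ∃ (lam mu : k) (hl0 : lam ≠ 0) (hl1 : lam ≠ 1) (hm0 : mu ≠ 0) (hm1 : mu ≠ 1),
      s = .skew lam hl0 hl1 ∧ t = .skew mu hm0 hm1 ∧ mu = lam⁻¹ := by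
  have h1 : HasNontrivialIdempotent s.alg ↔ HasNontrivialIdempotent t.alg :=
    ⟨.of_equiv e.toRingEquiv, .of_equiv e.symm.toRingEquiv⟩
  have h2 : HasRegularSquareZero s.alg ↔ HasRegularSquareZero t.alg :=
    ⟨.of_equiv e.toRingEquiv, .of_equiv e.symm.toRingEquiv⟩
  rw [hasNontrivialIdempotent_iff hs, hasNontrivialIdempotent_iff ht] at h1
  have hM := hasRegularSquareZero_matrix (k := k)
  have hC := not_hasRegularSquareZero_twoCycle (k := k)
  cases s with
  | split | splitDual | splitCubic | dualDual | quartic | squares => exact (hs trivial).elim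
  | matrix =>
    cases t with
    | split | splitDual | splitCubic | dualDual | quartic | squares => exact (ht trivial).elim
    | matrix => exact Or.inl rfl
    | twoCycle => exact (hC (h2.1 hM)).elim
    | jordan | skew => exact (h1.1 trivial).elim
  | twoCycle =>
    cases t with
    | split | splitDual | splitCubic | dualDual | quartic | squares => exact (ht trivial).elim
    | matrix => exact (hC (h2.2 hM)).elim
    | twoCycle => exact Or.inl rfl
    | jordan | skew => exact (h1.1 trivial).elim
  | jordan =>
    cases t with
    | split | splitDual | splitCubic | dualDual | quartic | squares => exact (ht trivial).elim
    | matrix | twoCycle => exact (h1.2 trivial).elim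
    | jordan => exact Or.inl rfl
    | skew mu hm0 hm1 => exact (not_jordan_equiv_skew mu hm0 hm1 ⟨e⟩).elim
  | skew lam hl0 hl1 =>
    cases t with
    | split | splitDual | splitCubic | dualDual | quartic | squares => exact (ht trivial).elim
    | matrix | twoCycle => exact (h1.2 trivial).elim
    | jordan => exact (not_jordan_equiv_skew lam hl0 hl1 ⟨e.symm⟩).elim
    | skew mu hm0 hm1 =>
      rcases eq_or_eq_inv_of_skew_equiv ⟨e⟩ with rfl | h
      · exact Or.inl rfl
      · exact Or.inr ⟨lam, mu, hl0, hl1, hm0, hm1, rfl, rfl, h⟩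

end FrobeniusTable

end Distinct

theorem mainTheorem2 (k : Type u) [Field k] [IsAlgClosed k] [CharZero k] :
    -- every algebra in the table is a 4-dimensional Frobenius algebra
    (∀ t : FrobeniusTable k,
      Module.finrank k t.alg = 4 ∧ IsFrobeniusAlgebra k t.alg) ∧
    -- exactly those in the first half are commutative
    (∀ t : FrobeniusTable k,
      (∀ a b : t.alg, a * b = b * a) ↔ t.InCommutativeHalf) ∧
    -- every 4-dimensional Frobenius algebra is isomorphic to one in the table
    (∀ (E : Type v) [Ring E] [Algebra k E],
      Module.finrank k E = 4 → IsFrobeniusAlgebra k E →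
        ∃ t : FrobeniusTable k, Nonempty (E ≃ₐ[k] t.alg)) ∧
    -- two entries give isomorphic algebras only if they are equal, or both in the family
    -- with inverse parameters
    (∀ s t : FrobeniusTable k,
      Nonempty (s.alg ≃ₐ[k] t.alg) ↔
        s = t ∨ ∃ (lam mu : k) (hl0 : lam ≠ 0) (hl1 : lam ≠ 1) (hm0 : mu ≠ 0) (hm1 : mu ≠ 1),
          s = .skew lam hl0 hl1 ∧ t = .skew mu hm0 hm1 ∧ mu = lam⁻¹) := by
  refine ⟨FrobeniusTable.finrank_eq_four_and_isFrobeniusAlgebra,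
    FrobeniusTable.commutative_iff_inCommutativeHalf,
    fun E _ _ => FrobeniusTable.exists_of_isFrobeniusAlgebra E, fun s t => ⟨?_, ?_⟩⟩
  · rintro ⟨e⟩
    have hcomm : s.InCommutativeHalf ↔ t.InCommutativeHalf := by
      rw [← FrobeniusTable.commutative_iff_inCommutativeHalf,
        ← FrobeniusTable.commutative_iff_inCommutativeHalf]
      exact ⟨commutative_of_equiv e, commutative_of_equiv e.symm⟩
    by_cases hs : s.InCommutativeHalf
    · exact Or.inl (FrobeniusTable.eq_of_equiv_of_inCommutativeHalf hs (hcomm.1 hs) e)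
    · exact FrobeniusTable.eq_or_inv_of_equiv_of_not_inCommutativeHalf hs (hs ∘ hcomm.2) e
  · rintro (rfl | ⟨lam, mu, hl0, hl1, hm0, hm1, rfl, rfl, rfl⟩)
    · exact ⟨AlgEquiv.refl⟩
    · exact FrobeniusTable.nonempty_skew_equiv_inv hl0 hl1 hm0 hm1
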